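/- Let $f\in\mathbb{C}[x,y]$ be a polynomial of the form $$f(x,y)=y^{n}+a_{1}(x)y^{n-1}+\cdots+a_{n}(x),\qquad n\geqslant 2,\quad \deg a_{i}\leqslant i\ \ (i=1,\dots,n),$$ and let $\lambda_{0}\in\mathbb{C}$. Write $|\cdot|$ for the maximum norm on $\mathbb{C}^{2}$. For a polynomial mapping $F:\mathbb{C}^{2}\to\mathbb{C}^{2}$ let $$N(F)=\{\nu\in\mathbb{R}:\ \exists A,B>0\ \forall z\in\mathbb{C}^{2}\ (|z|>B\Rightarrow|F(z)|\geqslant A|z|^{\nu})\},\qquad \mathcal{L}_{\infty}(F)=\sup N(F),$$ with $\sup\emptyset=-\infty$. For a function $\varphi$ meromorphic at $\infty\in\mathbb{C}\cup\{\infty\}$ let $\deg\varphi$ be the exponent of the leading term of its Laurent expansion at $\infty$ (and $\deg 0=-\infty$), and for a tuple of such functions let $\deg$ be the maximum of the degrees of its components. Define $$\mathcal{L}_{\infty,\lambda_{0}}(f)=\inf_{\Phi}\frac{\deg(\nabla f\circ\Phi)}{\deg\Phi}\in[-\infty,+\infty],$$ where $\Phi=(\varphi_{1},\varphi_{2})$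 runs over the pairs of functions meromorphic at $\infty$ with $\deg\Phi>0$ and $\deg\big((f-\lambda_{0})\circ\Phi\big)<0$. If $\mathcal{L}_{\infty}(f-\lambda_{0},f'_{y})<0$, then $$\mathcal{L}_{\infty,\lambda_{0}}(f)=\mathcal{L}_{\infty}(f-\lambda_{0},f'_{y})-1,$$ where $-\infty-1=-\infty$. -/

import Mathlib

namespace GradientAtInfinity

noncomputable section

/-- `φ` is meromorphic at `∞ ∈ ℂ ∪ {∞}`: in the coordinate `s = 1/t` it is meromorphic at `0`. -/
def MeromorphicAtInfty (φ : ℂ → ℂ) : Prop :=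
  MeromorphicAt (fun s : ℂ => φ s⁻¹) 0

/-- The degree at infinity: the exponent of the leading term of the Laurent expansion
`∑_{n ≤ k} aₙ tⁿ` at `∞`, that is, minus the order in the coordinate `s = 1/t`.
The zero germ has degree `-∞`. -/
def degInfty (φ : ℂ → ℂ) : EReal :=
  if meromorphicOrderAt (fun s : ℂ => φ s⁻¹) 0 = ⊤ then ⊥
  else ((-((meromorphicOrderAt (fun s : ℂ => φ s⁻¹) 0).untop₀ : ℝ) : ℝ) : EReal)

/-- The degree of a mapping is the maximum of the degrees of its components. -/
def degMap {m : ℕ} (Φ : Fin m → ℂ → ℂ) : EReal :=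
  ⨆ i, degInfty (Φ i)

/-- The composition `g ∘ Φ` of a polynomial with a curve `Φ = (φ₁, …, φₙ)`. -/
def polyComp {n : ℕ} (g : MvPolynomial (Fin n) ℂ) (Φ : Fin n → ℂ → ℂ) : ℂ → ℂ :=
  fun t => MvPolynomial.eval (fun i => Φ i t) g

/-- The gradient of a polynomial. -/
def grad {n : ℕ} (f : MvPolynomial (Fin n) ℂ) : Fin n → MvPolynomial (Fin n) ℂ :=
  fun i => MvPolynomial.pderiv i f

/-- The set `N(F)` of the exponents `ν` for which `|F(z)| ≥ A |z|^ν` for all large `z`; the norms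
on `Fin n → ℂ` and `Fin m → ℂ` are the maximum norms. -/
def lojSet {n m : ℕ} (F : Fin m → MvPolynomial (Fin n) ℂ) : Set ℝ :=
  {ν : ℝ | ∃ A > (0 : ℝ), ∃ B > (0 : ℝ), ∀ z : Fin n → ℂ,
    B < ‖z‖ → A * ‖z‖ ^ ν ≤ ‖fun j => MvPolynomial.eval z (F j)‖}

/-- The Łojasiewicz exponent at infinity `sup N(F)` of a polynomial mapping `F`; it is `-∞` when
`N(F)` is empty. -/
def lojExponent {n m : ℕ} (F : Fin m → MvPolynomial (Fin n) ℂ) : EReal :=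
  sSup ((fun ν : ℝ => (ν : EReal)) '' lojSet F)

/-- The curves that approximate the fibre `f = c` at infinity: `Φ` is meromorphic at infinity,
`deg Φ > 0` and `deg ((f - c) ∘ Φ) < 0`. -/
def fibreCurves {n : ℕ} (f : MvPolynomial (Fin n) ℂ) (c : ℂ) : Set (Fin n → ℂ → ℂ) :=
  {Φ | (∀ i, MeromorphicAtInfty (Φ i)) ∧ 0 < degMap Φ ∧
    degInfty (polyComp (f - MvPolynomial.C c) Φ) < 0}

/-- The Łojasiewicz exponent at infinity of `∇f` near the fibre `f = c`: the infimum of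
`deg (∇f ∘ Φ) / deg Φ` over the curves `Φ` approximating that fibre. -/
def lojExponentNearFibre {n : ℕ} (f : MvPolynomial (Fin n) ℂ) (c : ℂ) : EReal :=
  sInf ((fun Φ => degMap (fun i => polyComp (grad f i) Φ) / degMap Φ) '' fibreCurves f c)

end

end GradientAtInfinity

namespace GradientAtInfinity

open Filter Bornology Asymptotics Topology

/-! ### Degrees at infinity and growth -/

/-! Write `L` for the exponent of `(f - c, f'_y)`. Each inequality comes from differentiating `f -
c` along a curve.

Lower bound (valid for every `f`). Let `Φ` have degree `d` and let `(f - c) ∘ Φ` have degree `k <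
0`. An exponent `ν` of `(f - c, f'_y)` forces `ν d ≤ max k (deg f'_y ∘ Φ)`. Either `f'_y ∘ Φ`
already has degree at least `ν d`, or `ν d ≤ k`. In the second case, as `k ≠ 0`, the chain rule
gives `k - 1 ≤ deg (∇f ∘ Φ) + d - 1`. Both times `deg (∇f ∘ Φ) ≥ (ν - 1) d`; see
`lojExponent_sub_one_le`.

Upper bound. If `L < ν < 0`, there are points arbitrarily far out where `f - c` and `f'_y` are below
`|z| ^ ν`. Since `f` is monic in `y`, moving `y` to the nearest critical point of `f (x, ·)` shifts
it by at most 1 and multiplies the bound on `f - c` by a constant only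
(`exists_critical_point_near`); the condition `deg aᵢ ≤ i` keeps `y = O(x)`. By Puiseux's theorem
(`HasRootCurves.of_monic`) some branch `(t ^ m, γ t)` of `f'_y = 0` passes through such points for
unboundedly many `t`. A germ meromorphic at infinity has exact power growth, so these points alone
give `deg γ ≤ m` and `deg ((f - c) ∘ Φ) ≤ m ν`. With `f'_y ∘ Φ = 0` the chain rule expresses `f'_x ∘
Φ` as `((f - c) ∘ Φ)' / (m t ^ (m - 1))`, of degree at most `m (ν - 1)`. Letting `ν` decrease to `L`
finishes.

Puiseux's theorem is obtained by putting `x = exp (-2πiz)`: over a half plane the simple roots form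
a covering, hence extend to holomorphic functions of `z`. These are periodic with an integer period
`m`, so they descend to germs in `t`, where `t ^ m = x`. -/

theorem eventually_norm_gt (B : ℝ) : ∀ᶠ t in cobounded ℂ, B < ‖t‖ :=
  (tendsto_norm_cobounded_atTop (E := ℂ)).eventually_gt_atTop B

theorem eventually_cobounded_iff {p : ℂ → Prop} :
    (∀ᶠ t in cobounded ℂ, p t) ↔ ∃ B : ℝ, ∀ t, B < ‖t‖ → p t := by
  constructor
  · intro h
    obtain ⟨B, -, hB⟩ := (hasBasis_cobounded_norm (E := ℂ)).eventually_iff.1 h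
    exact ⟨B, fun t ht => hB ht.le⟩
  · rintro ⟨B, hB⟩
    exact (eventually_norm_gt B).mono hB

theorem eventually_nhdsNE_inv {p : ℂ → Prop} :
    (∀ᶠ s in 𝓝[≠] (0 : ℂ), p s⁻¹) ↔ ∀ᶠ t in cobounded ℂ, p t := by
  rw [← inv_nhdsNE_zero]; rfl

/-- A germ at infinity is either zero or comparable with a power of the variable. -/
theorem degInfty_eq_bot_or_isTheta {φ : ℂ → ℂ} (h : MeromorphicAtInfty φ) :
    (degInfty φ = ⊥ ∧ ∀ᶠ t in cobounded ℂ, φ t = 0) ∨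
      ∃ k : ℤ, meromorphicOrderAt (fun s : ℂ => φ s⁻¹) 0 = ((-k : ℤ) : WithTop ℤ) ∧
        degInfty φ = ((k : ℝ) : EReal) ∧ φ =Θ[cobounded ℂ] fun t => ‖t‖ ^ (k : ℝ) := by
  by_cases ho : meromorphicOrderAt (fun s : ℂ => φ s⁻¹) 0 = ⊤
  · left
    refine ⟨by simp [degInfty, ho], ?_⟩
    rw [meromorphicOrderAt_eq_top_iff] at ho
    exact eventually_nhdsNE_inv.1 ho
  · right
    obtain ⟨g, hg, hg0, hfg⟩ := (meromorphicOrderAt_ne_top_iff h).1 ho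
    set n := (meromorphicOrderAt (fun s : ℂ => φ s⁻¹) 0).untop₀ with hn
    refine ⟨-n, ?_, ?_, ?_⟩
    · rw [neg_neg, hn, WithTop.coe_untop₀_of_ne_top ho]
    · simp only [degInfty, ho, if_false, ← hn, Int.cast_neg]
    · have h1 : φ =ᶠ[cobounded ℂ] fun t => t⁻¹ ^ n * g t⁻¹ := by
        have := hfg
        refine (eventually_nhdsNE_inv (p := fun t => φ t = t⁻¹ ^ n * g t⁻¹)).1 ?_
        filter_upwards [hfg] with s hs
        simpa using hs
      have h2 : (fun t : ℂ => g t⁻¹) =Θ[cobounded ℂ] fun _ => (1 : ℝ) := by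
        have : Tendsto (fun t : ℂ => g t⁻¹) (cobounded ℂ) (𝓝 (g 0)) :=
          hg.continuousAt.tendsto.comp tendsto_inv₀_cobounded
        exact ((isEquivalent_const_iff_tendsto hg0).2 this).isTheta.trans
          ((isTheta_const_const_iff).2 (by simp [hg0]))
      have h3 : (fun t : ℂ => t⁻¹ ^ n) =Θ[cobounded ℂ] fun t => ‖t‖ ^ (((-n : ℤ)) : ℝ) := by
        refine IsTheta.of_norm_eventuallyEq ?_
        filter_upwards with t
        rw [Real.rpow_intCast, norm_zpow, norm_inv, inv_zpow']
      have h4 := h3.mul h2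
      simp only [mul_one] at h4
      refine h1.isTheta.trans (h4.trans ?_)
      exact isTheta_refl _ _

theorem isBigO_rpow_norm {r s : ℝ} (h : r ≤ s) :
    (fun t : ℂ => ‖t‖ ^ r) =O[cobounded ℂ] fun t => ‖t‖ ^ s := by
  refine IsBigO.of_bound 1 ?_
  filter_upwards [eventually_norm_gt 1] with t ht
  rw [one_mul, Real.norm_of_nonneg (by positivity), Real.norm_of_nonneg (by positivity)]
  exact Real.rpow_le_rpow_of_exponent_le ht.le h

theorem le_of_frequently_rpow_le {r s c : ℝ}
    (h : ∃ᶠ t in cobounded ℂ, ‖t‖ ^ r ≤ c * ‖t‖ ^ s) : r ≤ s := by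
  by_contra! hlt
  have h1 : Tendsto (fun t : ℂ => ‖t‖ ^ (r - s)) (cobounded ℂ) atTop :=
    (tendsto_rpow_atTop (sub_pos.2 hlt)).comp (tendsto_norm_cobounded_atTop (E := ℂ))
  refine h ?_
  filter_upwards [h1.eventually_gt_atTop c, eventually_norm_gt 0] with t ht h0
  rw [not_le]
  calc c * ‖t‖ ^ s < ‖t‖ ^ (r - s) * ‖t‖ ^ s := by
        exact mul_lt_mul_of_pos_right ht (Real.rpow_pos_of_pos h0 _)
    _ = ‖t‖ ^ r := by rw [← Real.rpow_add h0]; congr 1; ring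

theorem le_of_isBigO_rpow {r s : ℝ}
    (h : (fun t : ℂ => ‖t‖ ^ r) =O[cobounded ℂ] fun t => ‖t‖ ^ s) : r ≤ s := by
  obtain ⟨c, hc⟩ := h.bound
  refine le_of_frequently_rpow_le (c := c) (Eventually.frequently ?_)
  filter_upwards [hc] with t ht
  rwa [Real.norm_of_nonneg (by positivity), Real.norm_of_nonneg (by positivity)] at ht

theorem isBigO_of_degInfty_le {φ : ℂ → ℂ} (h : MeromorphicAtInfty φ) {r : ℝ}
    (hr : degInfty φ ≤ r) : φ =O[cobounded ℂ] fun t => ‖t‖ ^ r := by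
  rcases degInfty_eq_bot_or_isTheta h with ⟨-, h0⟩ | ⟨k, -, hk, hθ⟩
  · have : φ =ᶠ[cobounded ℂ] fun _ => (0 : ℂ) := h0
    exact this.trans_isBigO (isBigO_zero _ _)
  · rw [hk] at hr
    exact hθ.1.trans (isBigO_rpow_norm (by exact_mod_cast hr))

/-- A nonzero germ is bounded below by a multiple of the power given by its degree, so an estimate
on any unbounded set of `t` already controls the degree. This is how estimates at scattered points
become estimates for a whole branch. -/
theorem degInfty_le_of_frequently {φ : ℂ → ℂ} (h : MeromorphicAtInfty φ) {r c : ℝ}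
    (hr : ∃ᶠ t in cobounded ℂ, ‖φ t‖ ≤ c * ‖t‖ ^ r) : degInfty φ ≤ r := by
  rcases degInfty_eq_bot_or_isTheta h with ⟨h0, -⟩ | ⟨k, -, hk, hθ⟩
  · rw [h0]; exact bot_le
  · rw [hk]
    obtain ⟨C, hC, hb⟩ := hθ.2.exists_pos
    have : (k : ℝ) ≤ r := by
      refine le_of_frequently_rpow_le (c := C * c) ?_
      refine (hr.and_eventually hb.bound).mono fun t ht => ?_
      have h2 := ht.2
      rw [Real.norm_of_nonneg (by positivity)] at h2
      calc ‖t‖ ^ (k : ℝ) ≤ C * ‖φ t‖ := h2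
        _ ≤ C * (c * ‖t‖ ^ r) := by gcongr; exact ht.1
        _ = _ := by ring
    exact_mod_cast this

theorem degInfty_le_of_isBigO {φ : ℂ → ℂ} (h : MeromorphicAtInfty φ) {r : ℝ}
    (hr : φ =O[cobounded ℂ] fun t => ‖t‖ ^ r) : degInfty φ ≤ r := by
  obtain ⟨c, hc⟩ := hr.bound
  refine degInfty_le_of_frequently (c := c) h (Eventually.frequently ?_)
  filter_upwards [hc] with t ht
  rwa [Real.norm_of_nonneg (by positivity : (0 : ℝ) ≤ ‖t‖ ^ r)] at ht

theorem MeromorphicAtInfty.eventually_differentiableAt {φ : ℂ → ℂ} (h : MeromorphicAtInfty φ) :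
    ∀ᶠ t in cobounded ℂ, DifferentiableAt ℂ φ t := by
  have h1 : ∀ᶠ t in cobounded ℂ, AnalyticAt ℂ (fun s : ℂ => φ s⁻¹) t⁻¹ :=
    tendsto_inv₀_cobounded'.eventually (MeromorphicAt.eventually_analyticAt h)
  filter_upwards [h1, eventually_norm_gt 0] with t ht h0
  have ht0 : t ≠ 0 := norm_pos_iff.1 h0
  have := DifferentiableAt.comp t ht.differentiableAt (differentiableAt_inv ht0)
  simpa [Function.comp_def] using this

theorem deriv_comp_inv_germ {φ : ℂ → ℂ} (h : MeromorphicAtInfty φ) :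
    (fun s : ℂ => deriv φ s⁻¹) =ᶠ[𝓝[≠] 0]
      fun s => -s ^ 2 * deriv (fun s : ℂ => φ s⁻¹) s := by
  have h1 := eventually_nhdsNE_inv.2 h.eventually_differentiableAt
  filter_upwards [h1, self_mem_nhdsWithin] with s hs hs0
  have hs0 : s ≠ 0 := hs0
  have := (hs.hasDerivAt.comp s (hasDerivAt_inv hs0)).deriv
  simp only [Function.comp_def] at this
  rw [this]
  field_simp

theorem MeromorphicAtInfty.deriv {φ : ℂ → ℂ} (h : MeromorphicAtInfty φ) :
    MeromorphicAtInfty (deriv φ) := by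
  refine MeromorphicAt.congr ?_ (deriv_comp_inv_germ h).symm
  exact ((MeromorphicAt.id 0).pow 2).neg.mul (MeromorphicAt.deriv h)

theorem meromorphicOrderAt_deriv_inv {φ : ℂ → ℂ} (h : MeromorphicAtInfty φ) :
    meromorphicOrderAt (fun s : ℂ => deriv φ s⁻¹) 0 =
      2 + meromorphicOrderAt (_root_.deriv fun s : ℂ => φ s⁻¹) 0 := by
  rw [meromorphicOrderAt_congr (deriv_comp_inv_germ h)]
  have h2 : MeromorphicAt (fun s : ℂ => -s ^ 2) 0 := ((MeromorphicAt.id 0).pow 2).neg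
  have h3 : meromorphicOrderAt (fun s : ℂ => -s ^ 2) 0 = 2 := by
    refine (meromorphicOrderAt_eq_int_iff (n := 2) h2).2
      ⟨fun _ => -1, analyticAt_const, by simp, Eventually.of_forall fun s => ?_⟩
    rw [sub_zero, smul_eq_mul, mul_neg_one]
    rfl
  have := meromorphicOrderAt_mul h2 (MeromorphicAt.deriv h)
  rw [h3] at this
  exact this

/-- Differentiation lowers the exponent of the leading term by exactly one unless that term is
constant, hence `k ≠ 0`. -/
theorem degInfty_deriv {φ : ℂ → ℂ} (h : MeromorphicAtInfty φ) {k : ℤ} (hk : k ≠ 0)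
    (hφ : degInfty φ = ((k : ℝ) : EReal)) : degInfty (deriv φ) = (((k : ℝ) - 1 : ℝ) : EReal) := by
  rcases degInfty_eq_bot_or_isTheta h with ⟨h0, -⟩ | ⟨l, hl, hl', -⟩
  · rw [h0] at hφ; exact absurd hφ (EReal.bot_ne_coe _)
  · have : l = k := by rw [hl'] at hφ; exact_mod_cast hφ
    subst this
    have h1 := meromorphicOrderAt_deriv_eq_sub_one (f := fun s : ℂ => φ s⁻¹) (x := 0)
      (n := -l) (by simpa using hk) hl
    have h2 := meromorphicOrderAt_deriv_inv h
    rw [h1] at h2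
    have h3 : meromorphicOrderAt (fun s : ℂ => deriv φ s⁻¹) 0 = ((1 - l : ℤ) : WithTop ℤ) := by
      rw [h2, show (1 - l : ℤ) = 2 + (-l - 1) by ring]; rfl
    simp only [degInfty, h3]
    rw [if_neg (WithTop.coe_ne_top), WithTop.untop₀_coe]
    rw [show (-((1 - l : ℤ) : ℝ)) = (l : ℝ) - 1 by push_cast; ring]

theorem degInfty_deriv_le {φ : ℂ → ℂ} (h : MeromorphicAtInfty φ) {r : ℝ}
    (hr : degInfty φ ≤ r) : degInfty (deriv φ) ≤ ((r - 1 : ℝ) : EReal) := by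
  rcases degInfty_eq_bot_or_isTheta h with ⟨-, h0⟩ | ⟨k, hk, hk', -⟩
  · refine degInfty_le_of_isBigO h.deriv ?_
    obtain ⟨B, hB⟩ := eventually_cobounded_iff.1 h0
    have : deriv φ =ᶠ[cobounded ℂ] fun _ => (0 : ℂ) := by
      filter_upwards [eventually_norm_gt B] with t ht
      have : φ =ᶠ[𝓝 t] fun _ => 0 :=
        Filter.mem_of_superset
          ((isOpen_lt continuous_const continuous_norm).mem_nhds ht) hB
      rw [this.deriv_eq, deriv_const]
    exact this.trans_isBigO (isBigO_zero _ _)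
  -- In degree 0 the constant term disappears: in `s = 1/t` the germ extends analytically, its
  -- derivative has order at least 0, and the factor `-s ^ 2` leaves degree at most `-2 ≤ r - 1`.
  · by_cases hk0 : k = 0
    · subst hk0
      have h0 : 0 ≤ r := by rw [hk'] at hr; exact_mod_cast hr
      have han : 0 ≤ meromorphicOrderAt (_root_.deriv fun s : ℂ => φ s⁻¹) 0 := by
        obtain ⟨g, hg, hg0, hfg⟩ := (meromorphicOrderAt_eq_int_iff h).1 hk
        have : _root_.deriv (fun s : ℂ => φ s⁻¹) =ᶠ[𝓝[≠] 0] _root_.deriv g := by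
          refine EventuallyEq.nhdsNE_deriv ?_
          filter_upwards [hfg] with s hs
          simpa using hs
        rw [meromorphicOrderAt_congr this]
        exact hg.deriv.meromorphicOrderAt_nonneg
      have h2 := meromorphicOrderAt_deriv_inv h
      rcases degInfty_eq_bot_or_isTheta h.deriv with ⟨h3, -⟩ | ⟨l, hl, hl', -⟩
      · rw [h3]; exact bot_le
      · rw [hl']
        rw [hl] at h2
        have h5 : (2 : WithTop ℤ) ≤ ((-l : ℤ) : WithTop ℤ) := by
          rw [h2]; exact le_add_of_nonneg_right han
        have h6 : (2 : ℤ) ≤ -l := WithTop.coe_le_coe.1 h5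
        have h7 : (l : ℝ) ≤ -2 := by exact_mod_cast (by omega : l ≤ -2)
        exact_mod_cast (by linarith : (l : ℝ) ≤ r - 1)
    · rw [degInfty_deriv h hk0 hk']
      rw [hk'] at hr
      have : (k : ℝ) ≤ r := by exact_mod_cast hr
      exact_mod_cast (by linarith : (k : ℝ) - 1 ≤ r - 1)

theorem MeromorphicAtInfty.polyComp {n : ℕ} (g : MvPolynomial (Fin n) ℂ) {Φ : Fin n → ℂ → ℂ}
    (h : ∀ i, MeromorphicAtInfty (Φ i)) : MeromorphicAtInfty (polyComp g Φ) := by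
  induction g using MvPolynomial.induction_on with
  | C a =>
    have : GradientAtInfinity.polyComp (MvPolynomial.C a) Φ = fun _ => a := by
      funext t; simp [GradientAtInfinity.polyComp]
    rw [this]; exact MeromorphicAt.const a 0
  | add p q hp hq =>
    have : GradientAtInfinity.polyComp (p + q) Φ =
        GradientAtInfinity.polyComp p Φ + GradientAtInfinity.polyComp q Φ := by
      funext t; simp [GradientAtInfinity.polyComp]
    rw [this]; exact MeromorphicAt.add hp hq
  | mul_X p i hp =>
    have : GradientAtInfinity.polyComp (p * MvPolynomial.X i) Φ =
        GradientAtInfinity.polyComp p Φ * Φ i := by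
      funext t; simp [GradientAtInfinity.polyComp]
    rw [this]; exact MeromorphicAt.mul hp (h i)

/-- The chain rule for the composition of a polynomial with a curve. -/
theorem hasDerivAt_polyComp {n : ℕ} (g : MvPolynomial (Fin n) ℂ) {Φ : Fin n → ℂ → ℂ} {t : ℂ}
    (h : ∀ i, DifferentiableAt ℂ (Φ i) t) :
    HasDerivAt (polyComp g Φ) (∑ i, polyComp (grad g i) Φ t * deriv (Φ i) t) t := by
  induction g using MvPolynomial.induction_on with
  | C a =>
    have : polyComp (MvPolynomial.C a) Φ = fun _ => a := by
      funext t; simp [polyComp]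
    rw [this]
    simpa [polyComp, grad] using hasDerivAt_const t a
  | add p q hp hq =>
    have : polyComp (p + q) Φ = polyComp p Φ + polyComp q Φ := by
      funext t; simp [polyComp]
    rw [this]
    refine (hp.add hq).congr_deriv ?_
    rw [← Finset.sum_add_distrib]
    exact Finset.sum_congr rfl fun i _ => by simp [polyComp, grad, add_mul]
  | mul_X p i hp =>
    have : polyComp (p * MvPolynomial.X i) Φ = polyComp p Φ * Φ i := by
      funext t; simp [polyComp]
    rw [this]
    refine (hp.mul (h i).hasDerivAt).congr_deriv ?_
    have : ∀ j, polyComp (grad (p * MvPolynomial.X i) j) Φ t * deriv (Φ j) t =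
        polyComp (grad p j) Φ t * deriv (Φ j) t * Φ i t +
          (if j = i then polyComp p Φ t * deriv (Φ i) t else 0) := by
      intro j
      by_cases hj : j = i
      · subst hj
        simp [polyComp, grad, Derivation.leibniz]; ring
      · simp [polyComp, grad, Derivation.leibniz, MvPolynomial.pderiv_X, hj, Ne.symm hj]
        ring
    rw [Finset.sum_congr rfl fun j _ => this j, Finset.sum_add_distrib, Finset.sum_mul]
    simp

/-! ### The lower bound for the exponent near a fibre -/

theorem degMap_le_iff {m : ℕ} {Φ : Fin m → ℂ → ℂ} {r : EReal} :
    degMap Φ ≤ r ↔ ∀ i, degInfty (Φ i) ≤ r := iSup_le_iff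

/-- The degree of a curve that tends to infinity is a positive integer. -/
theorem exists_degMap_eq {n : ℕ} {Φ : Fin n → ℂ → ℂ} (h : ∀ i, MeromorphicAtInfty (Φ i))
    (hpos : 0 < degMap Φ) :
    ∃ d : ℤ, 0 < d ∧ degMap Φ = ((d : ℝ) : EReal) ∧ ∃ i, degInfty (Φ i) = ((d : ℝ) : EReal) := by
  obtain ⟨j, hj⟩ := lt_iSup_iff.1 hpos
  have : Nonempty (Fin n) := ⟨j⟩
  obtain ⟨i, hi⟩ := exists_eq_ciSup_of_finite (f := fun i => degInfty (Φ i))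
  have hi : degInfty (Φ i) = degMap Φ := hi
  rcases degInfty_eq_bot_or_isTheta (h i) with ⟨h0, -⟩ | ⟨k, -, hk, -⟩
  · rw [← hi, h0] at hpos; exact absurd hpos (by simp)
  · refine ⟨k, ?_, hi.symm.trans hk, i, hk⟩
    rw [← hi, hk] at hpos
    exact_mod_cast hpos

/-- The norm of a curve of degree `d` grows like `|t|^d`. -/
theorem isTheta_norm_curve {n : ℕ} {Φ : Fin n → ℂ → ℂ} (h : ∀ i, MeromorphicAtInfty (Φ i))
    {d : ℤ} (hd : degMap Φ = ((d : ℝ) : EReal)) {i : Fin n}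
    (hi : degInfty (Φ i) = ((d : ℝ) : EReal)) :
    (fun t => (fun j => Φ j t)) =Θ[cobounded ℂ] fun t => ‖t‖ ^ (d : ℝ) := by
  constructor
  · refine isBigO_pi.2 fun j => isBigO_of_degInfty_le (h j) ?_
    rw [← hd]; exact degMap_le_iff.1 le_rfl j
  · rcases degInfty_eq_bot_or_isTheta (h i) with ⟨h0, -⟩ | ⟨k, -, hk, hθ⟩
    · rw [h0] at hi; exact absurd hi (EReal.bot_ne_coe _)
    · have : k = d := by rw [hk] at hi; exact_mod_cast hi
      subst this
      refine hθ.2.trans (IsBigO.of_bound 1 (Eventually.of_forall fun t => ?_))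
      rw [one_mul]
      exact norm_le_pi_norm (fun j => Φ j t) i

/-- An exponent in `N(F)` bounds the degree of `F` along any curve tending to infinity. -/
theorem mul_le_degMap_polyComp {n m : ℕ} {F : Fin m → MvPolynomial (Fin n) ℂ}
    {Φ : Fin n → ℂ → ℂ} (h : ∀ i, MeromorphicAtInfty (Φ i)) {d : ℤ} (hd0 : 0 < d)
    (hd : degMap Φ = ((d : ℝ) : EReal)) {i : Fin n} (hi : degInfty (Φ i) = ((d : ℝ) : EReal))
    {ν : ℝ} (hν : ν ∈ lojSet F) {r : ℝ} (hr : ∀ j, degInfty (polyComp (F j) Φ) ≤ r) :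
    ν * d ≤ r := by
  obtain ⟨A, hA, B, hB, hAB⟩ := hν
  have hΘ := isTheta_norm_curve h hd hi
  have hF : (fun t => fun j => polyComp (F j) Φ t) =O[cobounded ℂ] fun t => ‖t‖ ^ r :=
    isBigO_pi.2 fun j => isBigO_of_degInfty_le (.polyComp _ h) (hr j)
  obtain ⟨C₁, hC₁, h₁⟩ := hΘ.1.exists_pos
  obtain ⟨C₂, hC₂, h₂⟩ := hΘ.2.exists_pos
  obtain ⟨C₃, hC₃, h₃⟩ := hF.exists_pos
  have hd' : (0 : ℝ) < d := by exact_mod_cast hd0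
  have hlarge : ∀ᶠ t in cobounded ℂ, C₂ * B < ‖t‖ ^ (d : ℝ) :=
    ((tendsto_rpow_atTop hd').comp
      (tendsto_norm_cobounded_atTop (E := ℂ))).eventually_gt_atTop _
  -- A lower bound for `‖Φ t‖ ^ ν`, whatever the sign of `ν`.
  obtain ⟨c, hc, hlow⟩ : ∃ c > 0, ∀ᶠ t in cobounded ℂ,
      c * (‖t‖ ^ (d : ℝ)) ^ ν ≤ ‖fun j => Φ j t‖ ^ ν := by
    rcases le_or_gt 0 ν with h0 | h0
    · refine ⟨(C₂⁻¹) ^ ν, by positivity, ?_⟩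
      filter_upwards [h₂.bound] with t ht
      rw [Real.norm_of_nonneg (by positivity)] at ht
      rw [← Real.mul_rpow (by positivity) (by positivity)]
      refine Real.rpow_le_rpow (by positivity) ?_ h0
      rwa [inv_mul_le_iff₀ hC₂]
    · refine ⟨C₁ ^ ν, by positivity, ?_⟩
      filter_upwards [h₁.bound, h₂.bound, eventually_norm_gt 0] with t ht ht2 ht0
      rw [Real.norm_of_nonneg (by positivity)] at ht ht2
      have hp : 0 < ‖t‖ ^ (d : ℝ) := by positivity
      have hΦ : 0 < ‖fun j => Φ j t‖ := pos_of_mul_pos_right (hp.trans_le ht2) hC₂.le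
      rw [← Real.mul_rpow (by positivity) (by positivity)]
      exact Real.rpow_le_rpow_of_nonpos hΦ ht h0.le
  refine le_of_frequently_rpow_le (c := (A * c)⁻¹ * C₃) (Eventually.frequently ?_)
  filter_upwards [hlow, h₂.bound, h₃.bound, hlarge, eventually_norm_gt 0]
    with t ht ht2 ht3 ht4 ht0
  rw [Real.norm_of_nonneg (by positivity)] at ht2 ht3
  have hBΦ : B < ‖fun j => Φ j t‖ := lt_of_mul_lt_mul_left (ht4.trans_le ht2) hC₂.le
  have h5 := hAB _ hBΦ
  rw [mul_comm ν, Real.rpow_mul (norm_nonneg t), mul_assoc, le_inv_mul_iff₀ (by positivity)]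
  calc A * c * (‖t‖ ^ (d : ℝ)) ^ ν = A * (c * (‖t‖ ^ (d : ℝ)) ^ ν) := by ring
    _ ≤ A * ‖fun j => Φ j t‖ ^ ν := by gcongr
    _ ≤ _ := h5
    _ ≤ _ := ht3

theorem grad_sub_C {n : ℕ} (f : MvPolynomial (Fin n) ℂ) (c : ℂ) :
    grad (f - MvPolynomial.C c) = grad f := by
  funext i; simp [grad]

/-- Differentiating `f - c` along a curve bounds the degree of the gradient from below. -/
theorem degInfty_sub_le_of_grad_le {n : ℕ} {g : MvPolynomial (Fin n) ℂ}
    {Φ : Fin n → ℂ → ℂ} (h : ∀ i, MeromorphicAtInfty (Φ i)) {d : ℝ}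
    (hd : degMap Φ ≤ (d : EReal)) {k : ℤ} (hk0 : k ≠ 0)
    (hk : degInfty (polyComp g Φ) = ((k : ℝ) : EReal)) {r : ℝ}
    (hr : degMap (fun i => polyComp (grad g i) Φ) ≤ (r : EReal)) : k - d ≤ r := by
  have hm := MeromorphicAtInfty.polyComp g h
  have h1 := degInfty_deriv hm hk0 hk
  have h2 : deriv (polyComp g Φ) =O[cobounded ℂ] fun t => ‖t‖ ^ (r + (d - 1)) := by
    have h3 : deriv (polyComp g Φ) =ᶠ[cobounded ℂ]
        fun t => ∑ i, polyComp (grad g i) Φ t * deriv (Φ i) t := by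
      filter_upwards [eventually_all.2 fun i => (h i).eventually_differentiableAt] with t ht
      exact (hasDerivAt_polyComp g ht).deriv
    refine h3.trans_isBigO (IsBigO.fun_sum fun i _ => ?_)
    have h4 := isBigO_of_degInfty_le (.polyComp (grad g i) h) (degMap_le_iff.1 hr i)
    have h5 := isBigO_of_degInfty_le (h i).deriv (degInfty_deriv_le (h i) (degMap_le_iff.1 hd i))
    refine (h4.mul h5).trans_eventuallyEq ?_
    filter_upwards [eventually_norm_gt 0] with t ht
    rw [Real.rpow_add ht]
  have h6 := degInfty_le_of_isBigO hm.deriv h2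
  rw [h1] at h6
  have : (k : ℝ) - 1 ≤ r + (d - 1) := by exact_mod_cast h6
  linarith

theorem lojExponent_sub_one_le (f : MvPolynomial (Fin 2) ℂ) (c : ℂ) :
    lojExponent ![f - MvPolynomial.C c, MvPolynomial.pderiv 1 f] - 1 ≤
      lojExponentNearFibre f c := by
  have h1b : (1 : EReal) ≠ ⊥ := EReal.coe_ne_bot 1
  have h1t : (1 : EReal) ≠ ⊤ := EReal.coe_ne_top 1
  refine le_sInf ?_
  rintro _ ⟨Φ, ⟨hΦ, hpos, hneg⟩, rfl⟩
  obtain ⟨d, hd0, hd, i, hi⟩ := exists_degMap_eq hΦ hpos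
  have hd' : (0 : ℝ) < d := by exact_mod_cast hd0
  rw [EReal.sub_le_iff_le_add (.inl h1b) (.inl h1t)]
  refine sSup_le ?_
  rintro _ ⟨ν, hν, rfl⟩
  rw [← EReal.sub_le_iff_le_add (.inl h1b) (.inl h1t)]
  dsimp only
  rw [hd,
    EReal.le_div_iff_mul_le (by exact_mod_cast hd') (by simp)]
  set G := degMap fun i => polyComp (grad f i) Φ with hG
  have key : ∀ r : ℝ, G ≤ r → (ν - 1) * d ≤ r := by
    intro r hr
    -- If `ν d ≤ r`, subtracting `d > 0` suffices. Otherwise `f'_y` is too small along the curve,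
    -- and `f - c` must account for the exponent `ν`.
    rcases le_or_gt (ν * d) r with h1 | h1
    · nlinarith
    · have hg1 : degInfty (polyComp (MvPolynomial.pderiv 1 f) Φ) ≤ r :=
        (degMap_le_iff.1 hr (1 : Fin 2) :)
      rcases degInfty_eq_bot_or_isTheta (.polyComp (f - MvPolynomial.C c) hΦ) with
        ⟨h0, -⟩ | ⟨k, -, hk, -⟩
      -- If `f = c` along the curve, both components have degree at most `r < ν d`, a contradiction.
      · have := mul_le_degMap_polyComp hΦ hd0 hd hi hν (r := r) (fun j => by
          fin_cases j
          · simp [h0]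
          · simpa using hg1)
        linarith
      · rw [hk] at hneg
        have hk0 : (k : ℝ) < 0 := by exact_mod_cast hneg
        have h2 := mul_le_degMap_polyComp hΦ hd0 hd hi hν (r := max r k) (fun j => by
          fin_cases j
          · exact hk.le.trans (EReal.coe_le_coe_iff.2 (le_max_right _ _))
          · exact hg1.trans (EReal.coe_le_coe_iff.2 (le_max_left _ _)))
        have h3 : ν * d ≤ k := by
          rcases le_max_iff.1 h2 with h | h
          · linarith
          · exact h
        have h4 := degInfty_sub_le_of_grad_le hΦ hd.le (by rintro rfl; simp at hk0) hk
          (r := r) (by rw [grad_sub_C]; exact hr)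
        linarith
  have : (((ν - 1) * d : ℝ) : EReal) ≤ G := EReal.le_of_forall_lt_iff_le.1
    fun z hz => by exact_mod_cast key z hz.le
  exact_mod_cast this

/-! ### Critical points of a polynomial near a small value -/

theorem norm_multiset_prod_sub_le {s : Multiset ℂ} {y z : ℂ}
    (h : ∀ b ∈ s, ‖z - b‖ ≤ 2 * ‖y - b‖) :
    ‖(s.map fun b => z - b).prod‖ ≤ 2 ^ s.card * ‖(s.map fun b => y - b).prod‖ := by
  induction s using Multiset.induction with
  | empty => simp
  | cons a s ih =>
    simp only [Multiset.map_cons, Multiset.prod_cons, norm_mul, Multiset.card_cons, pow_succ]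
    calc ‖z - a‖ * ‖(s.map fun b => z - b).prod‖
        ≤ (2 * ‖y - a‖) * (2 ^ s.card * ‖(s.map fun b => y - b).prod‖) := by
          gcongr
          · exact h a (Multiset.mem_cons_self a s)
          · exact ih fun b hb => h b (Multiset.mem_cons_of_mem hb)
      _ = _ := by ring

theorem pow_card_le_norm_multiset_prod {s : Multiset ℂ} {y : ℂ} {r : ℝ} (hr : 0 ≤ r)
    (h : ∀ b ∈ s, r ≤ ‖y - b‖) : r ^ s.card ≤ ‖(s.map fun b => y - b).prod‖ := by
  induction s using Multiset.induction with
  | empty => simp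
  | cons a s ih =>
    simp only [Multiset.map_cons, Multiset.prod_cons, norm_mul, Multiset.card_cons, pow_succ']
    gcongr
    · exact h a (Multiset.mem_cons_self a s)
    · exact ih fun b hb => h b (Multiset.mem_cons_of_mem hb)

/-- If a monic polynomial and its derivative are small at `y`, then near `y` there is a critical
point at which the polynomial is small. -/
theorem exists_critical_point_near {p : Polynomial ℂ} (hp : p.Monic) (hn : 2 ≤ p.natDegree)
    {y : ℂ} {ε : ℝ} (hε : ε ≤ 1) (h0 : ‖p.eval y‖ ≤ ε) (h1 : ‖p.derivative.eval y‖ ≤ ε) :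
    ∃ b, p.derivative.eval b = 0 ∧ ‖b - y‖ ≤ 1 ∧
      ‖p.eval b‖ ≤ (1 + 2 ^ (p.natDegree - 1)) * ε := by
  set q := p.derivative with hq
  have hqd : q.natDegree = p.natDegree - 1 := Polynomial.natDegree_derivative p
  have hlc : q.leadingCoeff = p.natDegree := by
    rw [Polynomial.leadingCoeff, hqd, hq, Polynomial.coeff_derivative,
      Nat.sub_add_cancel (by omega), hp.coeff_natDegree]
    push_cast [Nat.cast_sub (by omega : 1 ≤ p.natDegree)]
    ring
  have hsplit := IsAlgClosed.splits q
  have heval : ∀ z, q.eval z = p.natDegree * (q.roots.map fun b => z - b).prod := by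
    intro z
    rw [hsplit.eval_eq_prod_roots, hlc]
  have hcard : q.roots.card = p.natDegree - 1 := by
    rw [← hsplit.natDegree_eq_card_roots, hqd]
  have hq0 : q ≠ 0 := by
    rintro h; rw [h] at hqd; simp at hqd; omega
  have hne : q.roots.toFinset.Nonempty := by
    rw [Multiset.toFinset_nonempty]
    rintro h; rw [h] at hcard; simp at hcard; omega
  -- The point `b` is the critical point nearest to `y`. Were it at distance more than 1, the
  -- factorization of `q` would give `‖q y‖ ≥ n ≥ 2`, where `n` is the degree of `p`.
  obtain ⟨b, hb, hmin⟩ := q.roots.toFinset.exists_min_image (fun b => ‖y - b‖) hne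
  simp only [Multiset.mem_toFinset] at hb hmin
  have hbr : q.eval b = 0 := (Polynomial.mem_roots hq0).1 hb
  have hr1 : ‖y - b‖ ≤ 1 := by
    by_contra! hlt
    have h2 := pow_card_le_norm_multiset_prod (norm_nonneg (y - b)) hmin
    have h3 : ‖q.eval y‖ = p.natDegree * ‖(q.roots.map fun b => y - b).prod‖ := by
      rw [heval, norm_mul, Complex.norm_natCast]
    have h4 : 1 ≤ ‖y - b‖ ^ q.roots.card := one_le_pow₀ hlt.le
    have h5 : (2 : ℝ) ≤ p.natDegree := by exact_mod_cast hn
    nlinarith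
  -- On the disc about `y` reaching to `b`, each factor `z - b'` is at most twice `y - b'`, as no
  -- critical point is closer to `y` than `b`.
  have hbound : ∀ z ∈ Metric.closedBall y ‖y - b‖,
      ‖q.eval z‖ ≤ 2 ^ (p.natDegree - 1) * ‖q.eval y‖ := by
    intro z hz
    rw [heval, heval, norm_mul, norm_mul]
    have := norm_multiset_prod_sub_le (s := q.roots) (y := y) (z := z) fun b' hb' => by
      have h1 : ‖z - y‖ ≤ ‖y - b'‖ := (mem_closedBall_iff_norm.1 hz).trans (hmin b' hb')
      calc ‖z - b'‖ = ‖(z - y) + (y - b')‖ := by ring_nf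
        _ ≤ ‖z - y‖ + ‖y - b'‖ := norm_add_le _ _
        _ ≤ 2 * ‖y - b'‖ := by linarith
    rw [hcard] at this
    calc _ ≤ ‖(p.natDegree : ℂ)‖ * (2 ^ (p.natDegree - 1) *
          ‖(q.roots.map fun b => y - b).prod‖) := by gcongr
      _ = _ := by ring
  have hmv := (convex_closedBall y ‖y - b‖).norm_image_sub_le_of_norm_hasDerivWithin_le
    (f := fun z => p.eval z) (f' := fun z => q.eval z)
    (fun z _ => (p.hasDerivAt z).hasDerivWithinAt) hbound
    (Metric.mem_closedBall_self (norm_nonneg _))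
    (show b ∈ Metric.closedBall y ‖y - b‖ by rw [mem_closedBall_iff_norm, norm_sub_rev])
  refine ⟨b, hbr, by rwa [norm_sub_rev], ?_⟩
  have h6 : ‖p.eval b‖ ≤ ‖p.eval y‖ + ‖p.eval b - p.eval y‖ := by
    calc ‖p.eval b‖ = ‖p.eval y + (p.eval b - p.eval y)‖ := by ring_nf
      _ ≤ _ := norm_add_le _ _
  have h7 : (2 : ℝ) ^ (p.natDegree - 1) * ‖q.eval y‖ * ‖b - y‖ ≤
      2 ^ (p.natDegree - 1) * ε * 1 := by
    have : 0 ≤ ε := (norm_nonneg _).trans h1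
    gcongr
    rwa [norm_sub_rev]
  linarith

/-! ### Global implicit functions over convex domains -/

/-- The zero set of a function of two variables. -/
abbrev ZeroSet (F : ℂ × ℂ → ℂ) : Type := {p : ℂ × ℂ // F p = 0}

/-- The projection of the zero set to the first coordinate. -/
abbrev zeroProj (F : ℂ × ℂ → ℂ) : ZeroSet F → ℂ := fun e => e.1.1

/-- The local solution of `F (z, y) = 0` near a point with nonvanishing `y`-derivative. -/
theorem exists_local_root {F : ℂ × ℂ → ℂ} (hF : ContDiff ℂ 1 F) {u : ℂ × ℂ} (hu : F u = 0)
    (hd : deriv (fun y => F (u.1, y)) u.2 ≠ 0) :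
    ∃ ψ : ℂ → ℂ, (∀ᶠ v in 𝓝 u, F v = 0 ↔ ψ v.1 = v.2) ∧ ψ u.1 = u.2 ∧
      ∀ᶠ z in 𝓝 u.1, F (z, ψ z) = 0 ∧ DifferentiableAt ℂ ψ z := by
  have cdf : ContDiffAt ℂ 1 F u := hF.contDiffAt
  have hfd : HasFDerivAt F (fderiv ℂ F u) u :=
    (hF.differentiable one_ne_zero).differentiableAt.hasFDerivAt
  have hpair : HasFDerivAt (fun y : ℂ => (u.1, y)) (ContinuousLinearMap.inr ℂ ℂ ℂ) u.2 :=
    hasFDerivAt_prodMk_right u.1 u.2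
  have hcomp : HasFDerivAt (fun y => F (u.1, y))
      ((fderiv ℂ F u) ∘L ContinuousLinearMap.inr ℂ ℂ ℂ) u.2 :=
    HasFDerivAt.comp (g := F) u.2 hfd hpair
  have h1 : ((fderiv ℂ F u) ∘L ContinuousLinearMap.inr ℂ ℂ ℂ) 1 ≠ 0 := by
    rwa [← hcomp.hasDerivAt.deriv]
  -- A linear map of `ℂ` is multiplication by its value at 1, here the nonzero `y`-derivative.
  have hinv : ((fderiv ℂ F u) ∘L ContinuousLinearMap.inr ℂ ℂ ℂ).IsInvertible := by
    refine ⟨ContinuousLinearEquiv.unitsEquivAut ℂ (Units.mk0 _ h1), ?_⟩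
    ext
    simp
  refine ⟨cdf.implicitFunction one_ne_zero hinv, ?_, cdf.implicitFunction_apply_self _ _, ?_⟩
  · have := cdf.eventually_apply_eq_iff_implicitFunction one_ne_zero hinv
    rwa [hu] at this
  · have h2 := cdf.eventually_apply_implicitFunction one_ne_zero hinv
    rw [hu] at h2
    have h3 := (cdf.contDiffAt_implicitFunction one_ne_zero hinv).eventually (by simp)
    filter_upwards [h2, h3] with z hz hz'
    exact ⟨hz, hz'.differentiableAt one_ne_zero⟩

/-- The local inverse is `z ↦ (z, ψ z)` with `ψ` the implicit function; where this leaves the zero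
set, the point `e` serves as a default value. -/
theorem isLocalHomeomorphOn_zeroProj {F : ℂ × ℂ → ℂ} (hF : ContDiff ℂ 1 F) {s : Set ℂ}
    (hd : ∀ z ∈ s, ∀ y, F (z, y) = 0 → deriv (fun y => F (z, y)) y ≠ 0) :
    IsLocalHomeomorphOn (zeroProj F) (zeroProj F ⁻¹' s) := by
  classical
  intro e he
  obtain ⟨ψ, hψ, hψe, hz⟩ := exists_local_root hF e.2 (hd e.1.1 he e.1.2 e.2)
  obtain ⟨W, hW, hWo, heW⟩ := eventually_nhds_iff.1 hψ
  have hcont : ContinuousAt (fun z => (z, ψ z)) e.1.1 :=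
    continuousAt_id.prodMk hz.self_of_nhds.2.continuousAt
  have hWn : W ∈ 𝓝 (e.1.1, ψ e.1.1) := by
    rw [hψe]; exact hWo.mem_nhds heW
  obtain ⟨U, hU, hUo, heU⟩ := eventually_nhds_iff.1 (hz.and (hcont.eventually hWn))
  let φ : OpenPartialHomeomorph (ZeroSet F) ℂ :=
    { toFun := zeroProj F
      invFun := fun z => if h : F (z, ψ z) = 0 then ⟨(z, ψ z), h⟩ else e
      source := {p | p.1 ∈ W ∧ p.1.1 ∈ U}
      target := U
      map_source' := fun p hp => hp.2
      map_target' := fun z hz => by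
        rw [dif_pos (hU z hz).1.1]
        exact ⟨(hU z hz).2, hz⟩
      left_inv' := fun p hp => by
        rw [dif_pos (hU _ hp.2).1.1]
        exact Subtype.ext (Prod.ext rfl ((hW _ hp.1).1 p.2))
      right_inv' := fun z hz => by
        rw [dif_pos (hU z hz).1.1]
      open_source := (hWo.preimage continuous_subtype_val).inter
        (hUo.preimage (continuous_fst.comp continuous_subtype_val))
      open_target := hUo
      continuousOn_toFun := (continuous_fst.comp continuous_subtype_val).continuousOn
      continuousOn_invFun := by
        refine (Topology.IsInducing.subtypeVal (t := {p | F p = 0})).continuousOn_iff.2 ?_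
        have : ContinuousOn (fun z => (z, ψ z)) U := fun z hz =>
          (continuousAt_id.prodMk (hU z hz).1.2.continuousAt).continuousWithinAt
        refine this.congr fun z hz => ?_
        simp only [Function.comp_apply]
        rw [dif_pos (hU z hz).1.1] }
  exact ⟨φ, ⟨heW, heU⟩, rfl⟩

/-- The locally uniform bound on the roots makes the projection proper. -/
theorem isClosedMap_zeroProj {F : ℂ × ℂ → ℂ} (hF : Continuous F) {B : ℂ → ℝ}
    (hB : Continuous B) (hFB : ∀ z y, F (z, y) = 0 → ‖y‖ ≤ B z) : IsClosedMap (zeroProj F) := by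
  have hc : Continuous (zeroProj F) := continuous_fst.comp continuous_subtype_val
  have hclosed : IsClosed {p : ℂ × ℂ | F p = 0} := isClosed_eq hF continuous_const
  refine (isProperMap_iff_isCompact_preimage.2 ⟨hc, fun K hK => ?_⟩).isClosedMap
  obtain ⟨M, hM⟩ := hK.bddAbove_image hB.continuousOn
  have h1 : IsCompact ((Subtype.val : ZeroSet F → ℂ × ℂ) ⁻¹' (K ×ˢ Metric.closedBall 0 M)) :=
    hclosed.isClosedEmbedding_subtypeVal.isCompact_preimage
      (hK.prod (isCompact_closedBall 0 M))
  refine h1.of_isClosed_subset (hK.isClosed.preimage hc) fun e he => ⟨he, ?_⟩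
  rw [mem_closedBall_zero_iff]
  exact (hFB e.1.1 e.1.2 e.2).trans (hM ⟨_, he, rfl⟩)

/-- Over an open convex set where all roots of `F (z, ·)` are simple, finite in number and locally
bounded, every root extends uniquely to a holomorphic function. -/
theorem exists_global_root {F : ℂ × ℂ → ℂ} (hF : ContDiff ℂ 1 F) {s : Set ℂ} (hso : IsOpen s)
    (hs : Convex ℝ s) {B : ℂ → ℝ} (hB : Continuous B) (hFB : ∀ z y, F (z, y) = 0 → ‖y‖ ≤ B z)
    (hfin : ∀ z ∈ s, {y | F (z, y) = 0}.Finite)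
    (hd : ∀ z ∈ s, ∀ y, F (z, y) = 0 → deriv (fun y => F (z, y)) y ≠ 0)
    {z₀ y₀ : ℂ} (hz₀ : z₀ ∈ s) (hy₀ : F (z₀, y₀) = 0) :
    ∃ b : ℂ → ℂ, b z₀ = y₀ ∧ DifferentiableOn ℂ b s ∧ (∀ z ∈ s, F (z, b z) = 0) ∧
      ∀ b' : ℂ → ℂ, ContinuousOn b' s → (∀ z ∈ s, F (z, b' z) = 0) → b' z₀ = y₀ →
        Set.EqOn b' b s := by
  classical
  -- A closed local homeomorphism with finite fibres is a covering. Since `s` is convex, hence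
  -- contractible, its inclusion into `ℂ` lifts uniquely once the value at `z₀` is fixed.
  have hcov : IsCoveringMapOn (zeroProj F) s := by
    refine (isClosedMap_zeroProj hF.continuous hB hFB).isCoveringMapOn_of_isLocalHomeomorphOn
      (fun z hz => ?_) (isLocalHomeomorphOn_zeroProj hF hd)
    refine Set.Finite.of_finite_image (f := fun e : ZeroSet F => e.1.2)
      ((hfin z hz).subset ?_) ?_
    · rintro _ ⟨⟨⟨z', y⟩, h⟩, hz', rfl⟩
      have : z' = z := hz'
      subst this
      exact h
    · rintro ⟨⟨z₁, y₁⟩, h₁⟩ hz₁ ⟨⟨z₂, y₂⟩, h₂⟩ hz₂ h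
      have e1 : z₁ = z := hz₁
      have e2 : z₂ = z := hz₂
      have e3 : y₁ = y₂ := h
      subst e1 e2 e3
      rfl
  have : ContractibleSpace s := hs.contractibleSpace ⟨z₀, hz₀⟩
  have : LocallyPathConnectedSpace s := hso.locallyPathConnectedSpace
  obtain ⟨G, ⟨hG0, hG⟩, hGu⟩ := hcov.existsUnique_continuousMap_lifts
    (A := s) ⟨Subtype.val, continuous_subtype_val⟩ (a₀ := ⟨z₀, hz₀⟩) (e₀ := ⟨(z₀, y₀), hy₀⟩) rfl
    (fun a => a.2)
  have hG1 : ∀ z : s, (G z).1.1 = z := fun z => congrFun hG z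
  have hGF : ∀ z : s, F (z, (G z).1.2) = 0 := fun z => by
    have := (G z).2
    rwa [show (G z).1 = ((z : ℂ), (G z).1.2) from Prod.ext (hG1 z) rfl] at this
  let b : ℂ → ℂ := fun z => if h : z ∈ s then (G ⟨z, h⟩).1.2 else 0
  have hb : ∀ z (h : z ∈ s), b z = (G ⟨z, h⟩).1.2 := fun z h => dif_pos h
  have hbF : ∀ z ∈ s, F (z, b z) = 0 := fun z h => by rw [hb z h]; exact hGF ⟨z, h⟩
  have hbc : ContinuousOn b s := by
    rw [continuousOn_iff_continuous_domRestrict]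
    have : s.domRestrict b = fun z => (G z).1.2 := funext fun z => hb z z.2
    rw [this]
    exact continuous_snd.comp (continuous_subtype_val.comp G.continuous)
  refine ⟨b, ?_, ?_, hbF, ?_⟩
  · rw [hb z₀ hz₀, hG0]
  · intro z hz
    obtain ⟨ψ, hψ, -, hz'⟩ := exists_local_root hF (u := (z, b z)) (hbF z hz)
      (hd z hz _ (hbF z hz))
    have hcz : ContinuousAt b z := hbc.continuousAt (hso.mem_nhds hz)
    -- By continuity `b` stays where the implicit function is the only solution, and so inherits its
    -- differentiability.
    have h1 : ∀ᶠ w in 𝓝 z, ψ w = b w := by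
      filter_upwards [(continuousAt_id.prodMk hcz).eventually hψ, hso.mem_nhds hz] with w hw hws
      exact hw.1 (hbF w hws)
    exact (hz'.self_of_nhds.2.congr_of_eventuallyEq
      (h1.mono fun w hw => hw.symm)).differentiableWithinAt
  · intro b' hb'c hb'F hb'0 z hz
    let G' : C(s, ZeroSet F) := ⟨fun w => ⟨(w, b' w), hb'F w w.2⟩,
      (continuous_subtype_val.prodMk
        (continuousOn_iff_continuous_domRestrict.1 hb'c)).subtype_mk _⟩
    have := hGu G' ⟨Subtype.ext (Prod.ext rfl hb'0), rfl⟩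
    rw [hb z hz, ← this]
    rfl

open Polynomial

/-! ### Puiseux parametrizations at infinity -/

theorem exists_norm_eval_le (q : ℂ[X]) :
    ∃ N : ℕ, ∃ C : ℝ, 0 ≤ C ∧ ∀ x : ℂ, 1 ≤ ‖x‖ → ‖q.eval x‖ ≤ C * ‖x‖ ^ N := by
  refine ⟨q.natDegree, ∑ i ∈ Finset.range (q.natDegree + 1), ‖q.coeff i‖,
    Finset.sum_nonneg fun i _ => norm_nonneg _, fun x hx => ?_⟩
  rw [eval_eq_sum_range, Finset.sum_mul]
  refine (norm_sum_le _ _).trans (Finset.sum_le_sum fun i hi => ?_)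
  rw [norm_mul, norm_pow]
  gcongr
  exact Nat.lt_succ_iff.1 (Finset.mem_range.1 hi)

theorem contDiff_eval (q : ℂ[X]) : ContDiff ℂ 1 fun x => q.eval x := by
  simpa using q.contDiff_aeval (𝕜 := ℂ) 1

theorem evalEval_eq_sum (P : ℂ[X][X]) (x y : ℂ) :
    P.evalEval x y = ∑ i ∈ Finset.range (P.natDegree + 1), (P.coeff i).eval x * y ^ i := by
  rw [evalEval, eval_eq_sum_range (p := P), eval_finsetSum]
  simp

theorem hasDerivAt_evalEval (P : ℂ[X][X]) (x y : ℂ) :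
    HasDerivAt (fun y => P.evalEval x y) (P.derivative.evalEval x y) y := by
  have := (P.map (evalRingHom x)).hasDerivAt y
  rw [derivative_map, map_evalRingHom_eval] at this
  exact this.congr_of_eventuallyEq
    (Eventually.of_forall fun z => (map_evalRingHom_eval x z P).symm)

/-- A continuous bound for the roots of a monic polynomial. -/
noncomputable def rootBound (P : ℂ[X][X]) (x : ℂ) : ℝ :=
  1 + ∑ i ∈ Finset.range P.natDegree, ‖(P.coeff i).eval x‖

theorem continuous_rootBound (P : ℂ[X][X]) : Continuous (rootBound P) := by
  unfold rootBound
  fun_prop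

theorem norm_le_rootBound {P : ℂ[X][X]} (hP : P.Monic) {x y : ℂ} (h : P.evalEval x y = 0) :
    ‖y‖ ≤ rootBound P x := by
  unfold rootBound
  have hs : 0 ≤ ∑ i ∈ Finset.range P.natDegree, ‖(P.coeff i).eval x‖ :=
    Finset.sum_nonneg fun i _ => norm_nonneg _
  rcases le_or_gt ‖y‖ 1 with h1 | h1
  · linarith
  rw [evalEval_eq_sum, Finset.sum_range_succ, hP.coeff_natDegree, eval_one, one_mul] at h
  obtain ⟨n, hn⟩ : ∃ n, P.natDegree = n + 1 := by
    refine Nat.exists_eq_succ_of_ne_zero fun h0 => ?_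
    rw [h0] at h; simp at h
  have h2 : ‖y‖ ^ (n + 1) ≤ (∑ i ∈ Finset.range P.natDegree, ‖(P.coeff i).eval x‖) * ‖y‖ ^ n := by
    have h3 : y ^ (n + 1) = -∑ i ∈ Finset.range P.natDegree, (P.coeff i).eval x * y ^ i := by
      rw [← hn]; linear_combination h
    rw [← norm_pow, h3, norm_neg, Finset.sum_mul]
    refine (norm_sum_le _ _).trans (Finset.sum_le_sum fun i hi => ?_)
    rw [norm_mul, norm_pow]
    gcongr
    · exact h1.le
    · have := Finset.mem_range.1 hi; omega
  rw [pow_succ', mul_le_mul_iff_left₀ (by positivity)] at h2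
  linarith

theorem exists_rootBound_le (P : ℂ[X][X]) :
    ∃ N : ℕ, ∃ C : ℝ, 0 ≤ C ∧ ∀ x : ℂ, 1 ≤ ‖x‖ → rootBound P x ≤ C * ‖x‖ ^ N := by
  choose N C hC h using fun i => exists_norm_eval_le (P.coeff i)
  refine ⟨∑ i ∈ Finset.range P.natDegree, N i, 1 + ∑ i ∈ Finset.range P.natDegree, C i,
    add_nonneg zero_le_one (Finset.sum_nonneg fun i _ => hC i), fun x hx => ?_⟩
  rw [rootBound, add_mul, one_mul, Finset.sum_mul]
  refine add_le_add (one_le_pow₀ hx) (Finset.sum_le_sum fun i hi => (h i x hx).trans ?_)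
  have := Finset.single_le_sum (f := N) (fun _ _ => Nat.zero_le _) hi
  have h0 := hC i
  gcongr

theorem finite_roots {P : ℂ[X][X]} (hP : P.Monic) (x : ℂ) : {y | P.evalEval x y = 0}.Finite := by
  have h0 : P.map (evalRingHom x) ≠ 0 := (hP.map _).ne_zero
  refine (P.map (evalRingHom x)).roots.toFinset.finite_toSet.subset fun y hy => ?_
  simp only [Finset.mem_coe, Multiset.mem_toFinset, mem_roots h0, IsRoot.def,
    map_evalRingHom_eval]
  exact hy

/-- Away from a bounded set the roots of an irreducible monic polynomial are simple. -/
theorem exists_forall_root_simple {P : ℂ[X][X]} (hP : P.Monic) (hirr : Irreducible P) :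
    ∃ R : ℝ, ∀ x : ℂ, R < ‖x‖ → ∀ y, P.evalEval x y = 0 → P.derivative.evalEval x y ≠ 0 := by
  let K := FractionRing ℂ[X]
  have hinj : Function.Injective (algebraMap ℂ[X] K) := IsFractionRing.injective _ _
  have hirrK : Irreducible (P.map (algebraMap ℂ[X] K)) :=
    hP.irreducible_iff_irreducible_map_fraction_map.1 hirr
  have hcop : IsCoprime (P.map (algebraMap ℂ[X] K)) (P.derivative.map (algebraMap ℂ[X] K)) := by
    rw [← derivative_map]; exact hirrK.separable
  -- By Gauss's lemma `P` stays irreducible, hence separable, over the field of fractions. The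
  -- Bézout identity for the resultant `r` then shows that multiple roots occur only over the
  -- finitely many zeros of `r`.
  have hres : resultant P P.derivative ≠ 0 := by
    intro h0
    refine resultant_ne_zero _ _ hcop ?_
    rw [natDegree_map_eq_of_injective hinj, natDegree_map_eq_of_injective hinj,
      resultant_map_map, h0, map_zero]
  have hdeg : P.natDegree ≠ 0 := fun h0 => by
    rw [hP.natDegree_eq_zero.1 h0] at hirr
    exact not_irreducible_one hirr
  obtain ⟨u, v, -, -, huv⟩ := exists_mul_add_mul_eq_C_resultant P P.derivative le_rfl le_rfl
    (Or.inl hdeg)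
  set r := resultant P P.derivative
  obtain ⟨R, hR⟩ := (r.roots.toFinset.finite_toSet.isBounded.exists_norm_le)
  refine ⟨R, fun x hx y hy hy' => ?_⟩
  have h1 := congrArg (evalEval x y) huv
  rw [evalEval_add, evalEval_mul, evalEval_mul, hy, hy', evalEval_C, zero_mul, zero_mul,
    add_zero] at h1
  refine absurd (hR x ?_) (not_le.2 hx)
  simp only [Finset.mem_coe, Multiset.mem_toFinset, mem_roots hres, IsRoot.def, h1]

open Function.Periodic

/-- A holomorphic family of roots over a half plane that is periodic descends to a germ at
infinity. -/
theorem exists_branch_of_periodic {P : ℂ[X][X]} (hP : P.Monic) {M : ℝ} (hM : 0 ≤ M)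
    {b : ℂ → ℂ} (hb : DifferentiableOn ℂ b {z | M < z.im})
    (hroot : ∀ z : ℂ, M < z.im → P.evalEval (qParam 1 z)⁻¹ (b z) = 0) {m : ℕ} (hm : 0 < m)
    (hper : ∀ z : ℂ, M < z.im → b (z + m) = b z) :
    ∃ γ : ℂ → ℂ, MeromorphicAtInfty γ ∧
      (∀ᶠ t in cobounded ℂ, P.evalEval (t ^ m) (γ t) = 0) ∧
      ∀ z : ℂ, M < z.im → γ (qParam m z)⁻¹ = b z := by
  classical
  have hm' : (0 : ℝ) < m := by exact_mod_cast hm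
  have hq : ∀ z, qParam m z ^ m = qParam 1 z := fun z => by
    rw [qParam, qParam, ← Complex.exp_nat_mul]
    congr 1
    have : (m : ℂ) ≠ 0 := by exact_mod_cast hm.ne'
    push_cast
    field_simp
  obtain ⟨N, C, hC, hbound⟩ := exists_rootBound_le P
  -- Roots grow at most like `|x| ^ N`, so multiplying by `qParam 1 z ^ N = x ^ (-N)` gives a
  -- function bounded at the cusp, whose singularity in `t⁻¹` is removable. The value 0 off the half
  -- plane keeps `β` periodic everywhere.
  let β : ℂ → ℂ := fun z => if M < z.im then qParam 1 z ^ N * b z else 0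
  have hβ : ∀ z : ℂ, M < z.im → β z = qParam 1 z ^ N * b z := fun z hz => if_pos hz
  have hβper : Function.Periodic β ((m : ℝ) : ℂ) := by
    intro z
    have him : (z + ((m : ℝ) : ℂ)).im = z.im := by simp
    by_cases hz : M < z.im
    · rw [hβ _ (by rwa [him]), hβ _ hz]
      have h1 : qParam 1 (z + ((m : ℝ) : ℂ)) = qParam 1 z := by
        rw [qParam, qParam, Complex.exp_eq_exp_iff_exists_int]
        refine ⟨m, ?_⟩
        push_cast
        ring
      rw [h1]
      congr 1
      simpa using hper z hz
    · simp only [β, him, if_neg hz]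
  have hev : ∀ᶠ z in comap Complex.im atTop, M < z.im :=
    (eventually_gt_atTop M).comap _
  have hopen : IsOpen {z : ℂ | M < z.im} := isOpen_lt continuous_const Complex.continuous_im
  have hhol : ∀ᶠ z in comap Complex.im atTop, DifferentiableAt ℂ β z := by
    filter_upwards [hev] with z hz
    have hn := hopen.mem_nhds hz
    have h1 : DifferentiableAt ℂ (fun z => qParam 1 z ^ N * b z) z :=
      ((differentiable_qParam z).pow N).mul ((hb z hz).differentiableAt hn)
    exact h1.congr_of_eventuallyEq (Filter.mem_of_superset hn fun w hw => hβ w hw)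
  have hbd : BoundedAtFilter (comap Complex.im atTop) β := by
    refine IsBigO.of_bound C ?_
    filter_upwards [hev] with z hz
    have hq1 : ‖qParam 1 z‖ < 1 := norm_qParam_lt_one one_pos (hM.trans_lt hz)
    have hq0 : 0 < ‖qParam 1 z‖ := norm_pos_iff.2 (qParam_ne_zero z)
    have h1 := (norm_le_rootBound hP (hroot z hz)).trans (hbound (qParam 1 z)⁻¹ (by
      rw [norm_inv]; exact (one_le_inv₀ hq0).2 hq1.le))
    rw [norm_inv, inv_pow] at h1
    rw [hβ z hz, norm_mul, norm_pow, Pi.one_apply, norm_one, mul_one]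
    calc ‖qParam 1 z‖ ^ N * ‖b z‖ ≤ ‖qParam 1 z‖ ^ N * (C * (‖qParam 1 z‖ ^ N)⁻¹) := by gcongr
      _ = C := by field_simp
  have hcusp : AnalyticAt ℂ (cuspFunction m β) 0 := by
    rw [Complex.analyticAt_iff_eventually_differentiableAt]
    have h1 := eventually_differentiableAt_cuspFunction_nhds_ne_zero hm' hβper hhol
    have h2 := differentiableAt_cuspFunction_zero hm' hβper hhol hbd
    rw [eventually_nhdsWithin_iff] at h1
    filter_upwards [h1] with z hz
    by_cases h0 : z = 0
    · rw [h0]; exact h2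
    · exact hz h0
  -- The factor `t ^ (m * N) = x ^ N` undoes the normalization of `β`.
  let γ : ℂ → ℂ := fun t => t ^ (m * N) * cuspFunction m β t⁻¹
  have hγ : ∀ z : ℂ, M < z.im → γ (qParam m z)⁻¹ = b z := by
    intro z hz
    simp only [γ]
    rw [inv_inv, eq_cuspFunction hm'.ne' hβper, hβ z hz, inv_pow, pow_mul, hq,
      inv_mul_cancel_left₀ (pow_ne_zero _ (qParam_ne_zero z))]
  refine ⟨γ, ?_, ?_, hγ⟩
  · have : (fun s : ℂ => γ s⁻¹) = fun s => (s⁻¹) ^ (m * N) * cuspFunction m β s := by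
      funext s; simp [γ]
    rw [MeromorphicAtInfty, this]
    exact ((MeromorphicAt.id 0).inv.pow _).mul hcusp.meromorphicAt
  · have h1 : ∀ᶠ t in cobounded ℂ, M < (invQParam m t⁻¹).im :=
      tendsto_inv₀_cobounded'.eventually ((invQParam_tendsto hm').eventually hev)
    filter_upwards [h1, eventually_norm_gt 0] with t ht h0
    have ht0 : t ≠ 0 := norm_pos_iff.1 h0
    set z := invQParam m t⁻¹ with hz
    have hqz : qParam m z = t⁻¹ := qParam_right_inv hm'.ne' (inv_ne_zero ht0)
    have h2 := hγ z ht
    rw [hqz, inv_inv] at h2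
    have h3 := hroot z ht
    rwa [← hq, hqz, inv_pow, inv_inv, ← h2] at h3

/-- The zeros of `P` near infinity are covered by finitely many meromorphic curves
`t ↦ (t ^ m, γ t)`. -/
def HasRootCurves (P : ℂ[X][X]) : Prop :=
  ∃ R : ℝ, ∃ S : Set (ℕ × (ℂ → ℂ)), S.Finite ∧
    (∀ s ∈ S, 0 < s.1 ∧ MeromorphicAtInfty s.2 ∧
      ∀ᶠ t in cobounded ℂ, P.evalEval (t ^ s.1) (s.2 t) = 0) ∧
    ∀ x y : ℂ, R < ‖x‖ → P.evalEval x y = 0 → ∃ s ∈ S, ∃ t, t ^ s.1 = x ∧ s.2 t = y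

theorem HasRootCurves.mul {P Q : ℂ[X][X]} (hP : HasRootCurves P) (hQ : HasRootCurves Q) :
    HasRootCurves (P * Q) := by
  obtain ⟨R₁, S₁, hS₁, h₁, k₁⟩ := hP
  obtain ⟨R₂, S₂, hS₂, h₂, k₂⟩ := hQ
  refine ⟨max R₁ R₂, S₁ ∪ S₂, hS₁.union hS₂, ?_, ?_⟩
  · rintro s (hs | hs)
    · obtain ⟨a, b, c⟩ := h₁ s hs
      exact ⟨a, b, c.mono fun t ht => by rw [evalEval_mul, ht, zero_mul]⟩
    · obtain ⟨a, b, c⟩ := h₂ s hs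
      exact ⟨a, b, c.mono fun t ht => by rw [evalEval_mul, ht, mul_zero]⟩
  · intro x y hx hxy
    rw [evalEval_mul, mul_eq_zero] at hxy
    rcases hxy with h | h
    · obtain ⟨s, hs, t⟩ := k₁ x y ((le_max_left _ _).trans_lt hx) h
      exact ⟨s, Or.inl hs, t⟩
    · obtain ⟨s, hs, t⟩ := k₂ x y ((le_max_right _ _).trans_lt hx) h
      exact ⟨s, Or.inr hs, t⟩

/-- Irreducibility makes the roots simple for large `x`, so each root continues over a half plane in
`z`. The translations `z ↦ z + k` fix `x` and permute finitely many roots, which forces an integer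
period. -/
theorem HasRootCurves.of_irreducible {P : ℂ[X][X]} (hP : P.Monic) (hirr : Irreducible P) :
    HasRootCurves P := by
  obtain ⟨R, hR⟩ := exists_forall_root_simple hP hirr
  -- The half plane on which `|x| = exp (2 * π * Im z)` is large.
  obtain ⟨M, hM0, hM⟩ : ∃ M : ℝ, 0 ≤ M ∧ ∀ z : ℂ, M < z.im → R < ‖(qParam 1 z)⁻¹‖ := by
    have h1 : Tendsto (fun z => (qParam 1 z)⁻¹) (comap Complex.im atTop) (cobounded ℂ) :=
      tendsto_inv₀_nhdsNE_zero.comp (qParam_tendsto one_pos)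
    have h2 := h1.eventually (eventually_norm_gt R)
    rw [eventually_comap, eventually_atTop] at h2
    obtain ⟨M, hM⟩ := h2
    exact ⟨max M 0, le_max_right _ _,
      fun z hz => hM z.im ((le_max_left _ _).trans hz.le) z rfl⟩
  let s : Set ℂ := {z | M < z.im}
  let F : ℂ × ℂ → ℂ := fun p => P.evalEval (qParam 1 p.1)⁻¹ p.2
  have hF : ContDiff ℂ 1 F := by
    have hx : ContDiff ℂ 1 fun p : ℂ × ℂ => (qParam 1 p.1)⁻¹ :=
      ((contDiff_qParam 1).comp contDiff_fst).inv fun p => qParam_ne_zero _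
    have : F = fun p => ∑ i ∈ Finset.range (P.natDegree + 1),
        (P.coeff i).eval (qParam 1 p.1)⁻¹ * p.2 ^ i := funext fun p => evalEval_eq_sum P _ _
    rw [this]
    exact ContDiff.sum fun i _ =>
      ((contDiff_eval (P.coeff i)).comp hx).mul (contDiff_snd.pow i)
  have hopen : IsOpen s := isOpen_lt continuous_const Complex.continuous_im
  have hconv : Convex ℝ s := convex_halfSpace_im_gt M
  have hBc : Continuous fun z => rootBound P (qParam 1 z)⁻¹ :=
    (continuous_rootBound P).comp (continuous_qParam.inv₀ qParam_ne_zero)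
  have hlift := fun z₀ y₀ => exists_global_root (z₀ := z₀) (y₀ := y₀) hF hopen hconv hBc
    (fun z y h => norm_le_rootBound hP h) (fun z _ => finite_roots hP (qParam 1 z)⁻¹)
    (fun z hz y hy => by
      rw [show deriv (fun y => F (z, y)) y = _ from (hasDerivAt_evalEval P (qParam 1 z)⁻¹ y).deriv]
      exact hR _ (hM z hz) y hy)
  have hq1 : ∀ (z : ℂ) (k : ℕ), qParam 1 (z + k) = qParam 1 z := fun z k => by
    rw [qParam, qParam, Complex.exp_eq_exp_iff_exists_int]
    exact ⟨k, by push_cast; ring⟩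
  have him : ∀ (z : ℂ) (k : ℕ), (z + k).im = z.im := fun z k => by simp
  have hshift : ∀ z ∈ s, ∀ k : ℕ, z + k ∈ s := fun z hz k => by
    show M < (z + k).im
    rw [him]; exact hz
  -- Every root over the half plane comes from a periodic family.
  have hperiodic : ∀ b : ℂ → ℂ, ContinuousOn b s → (∀ z ∈ s, F (z, b z) = 0) →
      ∃ m : ℕ, 0 < m ∧ ∀ z ∈ s, b (z + m) = b z := by
    intro b hbc hbF
    have hz₀ : ((M + 1 : ℝ) : ℂ) * Complex.I ∈ s := by simp [s]
    set z₀ := ((M + 1 : ℝ) : ℂ) * Complex.I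
    have hbF' : ∀ k : ℕ, ∀ z ∈ s, F (z, b (z + k)) = 0 := fun k z hz => by
      have := hbF _ (hshift z hz k)
      simp only [F, hq1] at this ⊢
      exact this
    have hbc' : ∀ k : ℕ, ContinuousOn (fun z => b (z + k)) s := fun k =>
      hbc.comp (by fun_prop) fun z hz => hshift z hz k
    have hmaps : ∀ k : ℕ, b (z₀ + k) ∈ {y | P.evalEval (qParam 1 z₀)⁻¹ y = 0} :=
      fun k => hbF' k z₀ hz₀
    -- Pigeonhole: the values `b (z₀ + k)` are roots over one and the same `x`. Two shifts of `b`
    -- that agree at `z₀` agree everywhere by uniqueness, so `j - i` is a period.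
    obtain ⟨i, -, j, -, hij, heq⟩ := Set.infinite_univ.exists_ne_map_eq_of_mapsTo
      (f := fun k : ℕ => b (z₀ + k)) (fun k _ => hmaps k) (finite_roots hP _)
    wlog hlt : i < j generalizing i j
    · exact this j i hij.symm heq.symm (by omega)
    refine ⟨j - i, by omega, fun z hz => ?_⟩
    obtain ⟨g, -, -, -, hg⟩ := hlift z₀ (b (z₀ + i)) hz₀ (hbF' i z₀ hz₀)
    have h1 := hg _ (hbc' i) (hbF' i) rfl
    have h2 := hg _ (hbc' j) (hbF' j) heq.symm
    have hz' : z - i ∈ s := by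
      have : M < z.im := hz
      show M < (z - i).im
      simpa using this
    have h3 := (h1 hz').trans (h2 hz').symm
    simp only at h3
    rw [sub_add_cancel] at h3
    rw [h3]
    congr 1
    push_cast [Nat.cast_sub hlt.le]
    ring
  have hz₀ : ((M + 1 : ℝ) : ℂ) * Complex.I ∈ s := by simp [s]
  set z₀ := ((M + 1 : ℝ) : ℂ) * Complex.I
  -- One curve for each root over the base point.
  have hbranch : ∀ y₀ : ℂ, ∃ σ : ℕ × (ℂ → ℂ), F (z₀, y₀) = 0 →
      (0 < σ.1 ∧ MeromorphicAtInfty σ.2 ∧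
        ∀ᶠ t in cobounded ℂ, P.evalEval (t ^ σ.1) (σ.2 t) = 0) ∧
      ∀ b : ℂ → ℂ, ContinuousOn b s → (∀ z ∈ s, F (z, b z) = 0) → b z₀ = y₀ →
        ∀ z ∈ s, σ.2 (qParam σ.1 z)⁻¹ = b z := by
    intro y₀
    by_cases hy₀ : F (z₀, y₀) = 0
    · obtain ⟨b, -, hbd, hbF, hbu⟩ := hlift z₀ y₀ hz₀ hy₀
      obtain ⟨m, hm, hper⟩ := hperiodic b hbd.continuousOn hbF
      obtain ⟨γ, hγ, hγ0, hγb⟩ := exists_branch_of_periodic hP hM0 hbd hbF hm hper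
      exact ⟨(m, γ), fun _ => ⟨⟨hm, hγ, hγ0⟩, fun b' hb'c hb'F hb'0 z hz => by
        rw [hbu b' hb'c hb'F hb'0 hz]; exact hγb z hz⟩⟩
    · exact ⟨(0, 0), fun h => absurd h hy₀⟩
  choose σ hσ using hbranch
  have hS := finite_roots hP (qParam 1 z₀)⁻¹
  -- Since `|x| = exp (2π Im z)`, the bound `exp (2πM)` places every logarithm of `x` in the half
  -- plane.
  refine ⟨max (Real.exp (2 * Real.pi * M)) R, σ '' {y | P.evalEval (qParam 1 z₀)⁻¹ y = 0},
    hS.image σ, ?_, ?_⟩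
  · rintro _ ⟨y₀, hy₀, rfl⟩
    exact (hσ y₀ hy₀).1
  · intro x y hx hxy
    have hx0 : x ≠ 0 := by
      rintro rfl
      have := (le_max_left _ _).trans_lt hx
      rw [norm_zero] at this
      exact absurd this (not_lt.2 (Real.exp_pos _).le)
    set z := invQParam 1 x⁻¹ with hz
    have hqz : qParam 1 z = x⁻¹ := qParam_right_inv one_ne_zero (inv_ne_zero hx0)
    have hzs : z ∈ s := by
      show M < z.im
      rw [← norm_qParam_lt_iff one_pos, hqz, norm_inv, div_one, neg_mul, neg_mul, Real.exp_neg]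
      exact inv_strictAnti₀ (Real.exp_pos _) ((le_max_left _ _).trans_lt hx)
    -- The root `y` over `x` is continued back to the base point; its value there selects the curve.
    obtain ⟨b, hbz, hbd, hbF, -⟩ := hlift z y hzs (by simp only [F, hqz, inv_inv, hxy])
    have hy₀ : F (z₀, b z₀) = 0 := hbF z₀ hz₀
    obtain ⟨⟨hm, -, -⟩, h2⟩ := hσ (b z₀) hy₀
    refine ⟨_, ⟨b z₀, hy₀, rfl⟩, (qParam (σ (b z₀)).1 z)⁻¹, ?_, ?_⟩
    · have : qParam (σ (b z₀)).1 z ^ (σ (b z₀)).1 = qParam 1 z := by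
        rw [qParam, qParam, ← Complex.exp_nat_mul]
        congr 1
        have : ((σ (b z₀)).1 : ℂ) ≠ 0 := by exact_mod_cast hm.ne'
        push_cast
        field_simp
      rw [inv_pow, this, hqz, inv_inv]
    · rw [h2 b hbd.continuousOn hbF rfl z hzs, hbz]

/-- **Puiseux's theorem at infinity** for monic polynomials. -/
theorem HasRootCurves.of_monic {P : ℂ[X][X]} (hP : P.Monic) : HasRootCurves P := by
  induction hn : P.natDegree using Nat.strong_induction_on generalizing P with
  | _ n ih =>
    by_cases h1 : P = 1
    · subst h1
      exact ⟨0, ∅, Set.finite_empty, by simp, by simp⟩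
    by_cases hirr : Irreducible P
    · exact .of_irreducible hP hirr
    · rw [hP.irreducible_iff_natDegree] at hirr
      push Not at hirr
      obtain ⟨f, g, hf, hg, hfg, hf0, hg0⟩ := hirr h1
      have hd := hf.natDegree_mul hg
      rw [hfg] at hd
      rw [← hfg]
      exact (ih _ (by omega) hf rfl).mul (ih _ (by omega) hg rfl)

/-! ### Monic bivariate polynomials with `deg aᵢ ≤ i` -/

/-- The polynomial `y ^ n + a₁(x) y ^ (n - 1) + ⋯ + aₙ(x) - c` as a polynomial in `y`. -/
noncomputable def weighted (n : ℕ) (a : ℕ → ℂ[X]) (c : ℂ) : ℂ[X][X] :=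
  X ^ n + (∑ i ∈ Finset.Icc 1 n, C (a i) * X ^ (n - i) - C (C c))

theorem degree_weighted_tail_lt {n : ℕ} (hn : 1 ≤ n) (a : ℕ → ℂ[X]) (c : ℂ) :
    (∑ i ∈ Finset.Icc 1 n, C (a i) * X ^ (n - i) - C (C c) : ℂ[X][X]).degree < n := by
  refine (degree_sub_le _ _).trans_lt (max_lt ?_ ?_)
  · refine (degree_sum_le _ _).trans_lt ((Finset.sup_lt_iff (WithBot.bot_lt_coe n)).2
      fun i hi => (degree_C_mul_X_pow_le _ _).trans_lt ?_)
    have := Finset.mem_Icc.1 hi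
    exact WithBot.coe_lt_coe.2 (by omega : n - i < n)
  · exact degree_C_le.trans_lt (by exact_mod_cast hn)

theorem monic_weighted {n : ℕ} (hn : 1 ≤ n) (a : ℕ → ℂ[X]) (c : ℂ) : (weighted n a c).Monic :=
  monic_X_pow_add (degree_weighted_tail_lt hn a c)

theorem natDegree_weighted {n : ℕ} (hn : 1 ≤ n) (a : ℕ → ℂ[X]) (c : ℂ) :
    (weighted n a c).natDegree = n := by
  rw [weighted, natDegree_add_eq_left_of_degree_lt, natDegree_X_pow]
  rw [degree_X_pow]
  exact degree_weighted_tail_lt hn a c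

theorem evalEval_weighted (n : ℕ) (a : ℕ → ℂ[X]) (c x y : ℂ) :
    (weighted n a c).evalEval x y =
      y ^ n + (∑ i ∈ Finset.Icc 1 n, (a i).eval x * y ^ (n - i) - c) := by
  simp [weighted, evalEval_finsetSum, evalEval_sub, evalEval_C]

theorem eval_aeval_X (z : Fin 2 → ℂ) (q : ℂ[X]) :
    MvPolynomial.eval z (aeval (MvPolynomial.X 0) q) = q.eval (z 0) := by
  rw [aeval_def, hom_eval₂, MvPolynomial.eval_X]
  have : (MvPolynomial.eval z).comp (algebraMap ℂ (MvPolynomial (Fin 2) ℂ)) = RingHom.id ℂ := by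
    ext; simp
  rw [this, eval₂_id]

theorem norm_eval_le_of_natDegree_le {q : ℂ[X]} {i : ℕ} (h : q.natDegree ≤ i) (x : ℂ) :
    ‖q.eval x‖ ≤ (∑ j ∈ Finset.range (q.natDegree + 1), ‖q.coeff j‖) * (1 + ‖x‖) ^ i := by
  rw [eval_eq_sum_range, Finset.sum_mul]
  refine (norm_sum_le _ _).trans (Finset.sum_le_sum fun j hj => ?_)
  rw [norm_mul, norm_pow]
  have h1 : ‖x‖ ^ j ≤ (1 + ‖x‖) ^ i :=
    (pow_le_pow_left₀ (norm_nonneg x) (by linarith) j).trans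
      (pow_le_pow_right₀ (by linarith [norm_nonneg x])
        ((Nat.lt_succ_iff.1 (Finset.mem_range.1 hj)).trans h))
  gcongr

/-- Where the polynomial is small, `y` grows at most linearly in `x`. -/
theorem exists_norm_le_of_norm_weighted_le {n : ℕ} (hn : 1 ≤ n) {a : ℕ → ℂ[X]}
    (ha : ∀ i ∈ Finset.Icc 1 n, (a i).natDegree ≤ i) (c : ℂ) :
    ∃ D : ℝ, 1 ≤ D ∧ ∀ x y : ℂ, ‖(weighted n a c).evalEval x y‖ ≤ 1 → ‖y‖ ≤ D * (1 + ‖x‖) := by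
  let A : ℕ → ℝ := fun i => ∑ j ∈ Finset.range ((a i).natDegree + 1), ‖(a i).coeff j‖
  have hA : ∀ i, 0 ≤ A i := fun i => Finset.sum_nonneg fun j _ => norm_nonneg _
  have hAs : 0 ≤ ∑ i ∈ Finset.Icc 1 n, A i := Finset.sum_nonneg fun i _ => hA i
  refine ⟨1 + ‖c‖ + ∑ i ∈ Finset.Icc 1 n, A i, by linarith [norm_nonneg c], fun x y h => ?_⟩
  have hX : 1 ≤ 1 + ‖x‖ := by linarith [norm_nonneg x]
  rcases le_or_gt ‖y‖ (1 + ‖x‖) with hy | hy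
  · nlinarith [norm_nonneg c]
  have hy1 : 1 ≤ ‖y‖ := hX.trans hy.le
  have h1 : ‖y‖ ^ n ≤ ((1 + ‖c‖ + ∑ i ∈ Finset.Icc 1 n, A i) * (1 + ‖x‖)) * ‖y‖ ^ (n - 1) := by
    have h2 : y ^ n = (weighted n a c).evalEval x y -
        ∑ i ∈ Finset.Icc 1 n, (a i).eval x * y ^ (n - i) + c := by
      rw [evalEval_weighted]; ring
    have hbase : 1 ≤ (1 + ‖x‖) * ‖y‖ ^ (n - 1) := one_le_mul_of_one_le_of_one_le hX
      (one_le_pow₀ hy1)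
    -- Each `a i` is `O((1 + |x|) ^ i)`. As `1 + |x| < |y|`, all but one of these `i` factors can be
    -- traded for `|y|`, leaving a bound linear in `1 + |x|`.
    have h3 : ‖∑ i ∈ Finset.Icc 1 n, (a i).eval x * y ^ (n - i)‖ ≤
        (∑ i ∈ Finset.Icc 1 n, A i) * ((1 + ‖x‖) * ‖y‖ ^ (n - 1)) := by
      rw [Finset.sum_mul]
      refine (norm_sum_le _ _).trans (Finset.sum_le_sum fun i hi => ?_)
      obtain ⟨hi1, hin⟩ := Finset.mem_Icc.1 hi
      rw [norm_mul, norm_pow]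
      calc ‖(a i).eval x‖ * ‖y‖ ^ (n - i) ≤ (A i * (1 + ‖x‖) ^ i) * ‖y‖ ^ (n - i) := by
            gcongr; exact norm_eval_le_of_natDegree_le (ha i hi) x
        _ = A i * ((1 + ‖x‖) * ((1 + ‖x‖) ^ (i - 1) * ‖y‖ ^ (n - i))) := by
            obtain ⟨k, rfl⟩ := Nat.exists_eq_add_of_le hi1
            rw [Nat.add_sub_cancel_left, pow_add]; ring
        _ ≤ A i * ((1 + ‖x‖) * (‖y‖ ^ (i - 1) * ‖y‖ ^ (n - i))) := by
            have := hA i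
            gcongr
        _ = A i * ((1 + ‖x‖) * ‖y‖ ^ (n - 1)) := by
            rw [← pow_add, show i - 1 + (n - i) = n - 1 by omega]
    rw [← norm_pow, h2]
    calc _ ≤ ‖(weighted n a c).evalEval x y‖ +
          ‖∑ i ∈ Finset.Icc 1 n, (a i).eval x * y ^ (n - i)‖ + ‖c‖ :=
          (norm_add_le _ _).trans (by gcongr; exact norm_sub_le _ _)
      _ ≤ 1 * ((1 + ‖x‖) * ‖y‖ ^ (n - 1)) +
          (∑ i ∈ Finset.Icc 1 n, A i) * ((1 + ‖x‖) * ‖y‖ ^ (n - 1)) +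
          ‖c‖ * ((1 + ‖x‖) * ‖y‖ ^ (n - 1)) := by
          gcongr
          · rw [one_mul]; exact h.trans hbase
          · exact le_mul_of_one_le_right (norm_nonneg c) hbase
      _ = _ := by ring
  obtain ⟨k, rfl⟩ := Nat.exists_eq_add_of_le' hn
  rw [Nat.add_sub_cancel, pow_succ', mul_le_mul_iff_left₀ (by positivity)] at h1
  exact h1

/-- Points near infinity where the polynomial and its `y`-derivative are small can be moved to
the polar curve. -/
theorem exists_polar_points {n : ℕ} (hn : 2 ≤ n) {a : ℕ → ℂ[X]}
    (ha : ∀ i ∈ Finset.Icc 1 n, (a i).natDegree ≤ i) {c : ℂ} {ν : ℝ} (hν : ν < 0)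
    (h : ∀ B > (0 : ℝ), ∃ x y : ℂ, B < max ‖x‖ ‖y‖ ∧
      ‖(weighted n a c).evalEval x y‖ ≤ max ‖x‖ ‖y‖ ^ ν ∧
      ‖(weighted n a c).derivative.evalEval x y‖ ≤ max ‖x‖ ‖y‖ ^ ν) :
    ∃ K : ℝ, ∀ B : ℝ, ∃ x b : ℂ, B < ‖x‖ ∧ (weighted n a c).derivative.evalEval x b = 0 ∧
      ‖(weighted n a c).evalEval x b‖ ≤ K * ‖x‖ ^ ν ∧ ‖b‖ ≤ K * ‖x‖ := by
  obtain ⟨D, hD, hDb⟩ := exists_norm_le_of_norm_weighted_le (by omega : 1 ≤ n) ha c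
  have hmonic := monic_weighted (by omega : 1 ≤ n) a c
  -- The first constant is the loss in `exists_critical_point_near`; the second comes from `‖b‖ ≤ 1
  -- + D (1 + ‖x‖)` with `‖x‖ > 1`.
  refine ⟨max (1 + 2 ^ (n - 1)) (1 + 2 * D), fun B => ?_⟩
  have hB1 : 1 ≤ max B 1 := le_max_right _ _
  have hB' : max B 1 ≤ D * (1 + max B 1) := by nlinarith
  -- This threshold forces `‖x‖` itself to be large: if `‖x‖ ≤ max B 1`, both coordinates would be
  -- at most `D (1 + max B 1)`.
  obtain ⟨x, y, hxy, h0, h1⟩ := h (D * (1 + max B 1)) (by positivity)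
  have hε : max ‖x‖ ‖y‖ ^ ν ≤ 1 :=
    Real.rpow_le_one_of_one_le_of_nonpos (by linarith) hν.le
  have hy := hDb x y (h0.trans hε)
  have hx : max B 1 < ‖x‖ := by
    by_contra! hle
    refine absurd hxy (not_lt.2 (max_le (hle.trans hB') (hy.trans ?_)))
    gcongr
  have hx1 : 1 < ‖x‖ := hB1.trans_lt hx
  have hdeg : ((weighted n a c).map (evalRingHom x)).natDegree = n := by
    rw [hmonic.natDegree_map, natDegree_weighted (by omega)]
  obtain ⟨b, hb0, hby, hb⟩ := exists_critical_point_near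
    (p := (weighted n a c).map (evalRingHom x)) (hmonic.map _) (by omega) hε
    (by rwa [map_evalRingHom_eval]) (by rwa [derivative_map, map_evalRingHom_eval])
  rw [derivative_map, map_evalRingHom_eval] at hb0
  rw [map_evalRingHom_eval, hdeg] at hb
  refine ⟨x, b, (le_max_left _ _).trans_lt hx, hb0, hb.trans ?_, ?_⟩
  · have : max ‖x‖ ‖y‖ ^ ν ≤ ‖x‖ ^ ν :=
      Real.rpow_le_rpow_of_nonpos (by linarith) (le_max_left _ _) hν.le
    gcongr
    exact le_max_left _ _
  · have h2 : ‖b‖ ≤ ‖b - y‖ + ‖y‖ := by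
      calc ‖b‖ = ‖(b - y) + y‖ := by ring_nf
        _ ≤ _ := norm_add_le _ _
    calc ‖b‖ ≤ 1 + D * (1 + ‖x‖) := by linarith
      _ ≤ (1 + 2 * D) * ‖x‖ := by nlinarith
      _ ≤ _ := by gcongr; exact le_max_right _ _

/-- One parametrized branch of the polar curve passes through infinitely many given points. -/
theorem exists_polar_branch {n : ℕ} (hn : 2 ≤ n) {a : ℕ → ℂ[X]} {c : ℂ} {p : ℂ → ℂ → Prop}
    (h : ∀ B : ℝ, ∃ x b : ℂ, B < ‖x‖ ∧ (weighted n a c).derivative.evalEval x b = 0 ∧ p x b) :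
    ∃ m : ℕ, 0 < m ∧ ∃ γ : ℂ → ℂ, MeromorphicAtInfty γ ∧
      (∀ᶠ t in cobounded ℂ, (weighted n a c).derivative.evalEval (t ^ m) (γ t) = 0) ∧
      ∃ᶠ t in cobounded ℂ, p (t ^ m) (γ t) := by
  have hn0 : (n : ℂ) ≠ 0 := by exact_mod_cast (by omega : n ≠ 0)
  -- Dividing by `n` makes the polar polynomial monic without changing its zeros.
  set Q : ℂ[X][X] := C (C (n : ℂ)⁻¹) * (weighted n a c).derivative with hQ
  have hQe : ∀ x y, Q.evalEval x y = 0 ↔ (weighted n a c).derivative.evalEval x y = 0 := by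
    intro x y
    rw [hQ, evalEval_mul, evalEval_C, eval_C, mul_eq_zero, or_iff_right (inv_ne_zero hn0)]
  have hQm : Q.Monic := by
    refine monic_C_mul_of_mul_leadingCoeff_eq_one ?_
    have hlc : (weighted n a c).coeff n = 1 := by
      have := (monic_weighted (by omega : 1 ≤ n) a c).coeff_natDegree
      rwa [natDegree_weighted (by omega)] at this
    rw [leadingCoeff, natDegree_derivative, coeff_derivative, natDegree_weighted (by omega),
      Nat.sub_add_cancel (by omega), hlc, one_mul]
    have : ((n - 1 : ℕ) : ℂ[X]) + 1 = C (n : ℂ) := by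
      push_cast [Nat.cast_sub (by omega : 1 ≤ n)]
      simp
    rw [this, ← C_mul, inv_mul_cancel₀ hn0, C_1]
  obtain ⟨R, S, hS, hS1, hS2⟩ := HasRootCurves.of_monic hQm
  by_contra! hcon
  -- If `p` failed on each of the finitely many branches for large `t`, it would fail at every point
  -- of the polar curve over large `x`.
  have key : ∀ s ∈ S, ∀ᶠ x in cobounded ℂ, ∀ t, t ^ s.1 = x → ¬ p x (s.2 t) := by
    intro s hs
    obtain ⟨hm, hγ, h0⟩ := hS1 s hs
    have h1 := hcon s.1 hm s.2 hγ (h0.mono fun t ht => (hQe _ _).1 ht)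
    obtain ⟨B, hB⟩ := eventually_cobounded_iff.1 h1
    filter_upwards [eventually_norm_gt (max B 0 ^ s.1)] with x hx t ht
    rw [← ht]
    refine hB t ?_
    rw [← ht, norm_pow] at hx
    exact (le_max_left _ _).trans_lt (lt_of_pow_lt_pow_left₀ _ (norm_nonneg t) hx)
  obtain ⟨B, hB⟩ := eventually_cobounded_iff.1 ((eventually_all_finite hS).2 key)
  obtain ⟨x, b, hx, hb, hp⟩ := h (max B R)
  obtain ⟨s, hs, t, ht, rfl⟩ := hS2 x b ((le_max_right _ _).trans_lt hx) ((hQe x b).2 hb)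
  exact hB x ((le_max_left _ _).trans_lt hx) s hs t ht hp

/-! ### The upper bound for the exponent near a fibre -/

theorem meromorphicAtInfty_pow (m : ℕ) : MeromorphicAtInfty fun t => t ^ m :=
  (MeromorphicAt.id 0).inv.pow m

theorem degInfty_pow (m : ℕ) : degInfty (fun t => t ^ m) = ((m : ℝ) : EReal) := by
  have hn : (fun t : ℂ => t ^ m) =Θ[cobounded ℂ] fun t => ‖t‖ ^ (m : ℝ) := by
    refine IsTheta.of_norm_eventuallyEq (Eventually.of_forall fun t => ?_)
    simp
  refine le_antisymm (degInfty_le_of_isBigO (meromorphicAtInfty_pow m) hn.1) ?_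
  rcases degInfty_eq_bot_or_isTheta (meromorphicAtInfty_pow m) with ⟨-, h0⟩ | ⟨k, -, hk, hθ⟩
  · exfalso
    obtain ⟨t, ht, ht0⟩ := (h0.and (eventually_norm_gt 0)).exists
    exact pow_ne_zero m (norm_pos_iff.1 ht0) ht
  · rw [hk]
    exact EReal.coe_le_coe_iff.2 (le_of_isBigO_rpow (hn.2.trans hθ.1))

/-- Along a curve `(t ^ m, γ t)` on which `∂f/∂y` vanishes, the degree of the gradient is governed
by the degree of `f - c`. -/
theorem lojExponentNearFibre_le_of_polar {f : MvPolynomial (Fin 2) ℂ} {c : ℂ} {m : ℕ} (hm : 0 < m)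
    {γ : ℂ → ℂ} (hγ : MeromorphicAtInfty γ) (hγm : degInfty γ ≤ ((m : ℝ) : EReal)) {ν : ℝ}
    (hν : ν < 0)
    (hy : ∀ᶠ t in cobounded ℂ,
      polyComp (MvPolynomial.pderiv 1 f) ![fun t => t ^ m, γ] t = 0)
    (hdeg : degInfty (polyComp (f - MvPolynomial.C c) ![fun t => t ^ m, γ]) ≤
      ((m * ν : ℝ) : EReal)) :
    lojExponentNearFibre f c ≤ ((ν - 1 : ℝ) : EReal) := by
  have hm' : (0 : ℝ) < m := by exact_mod_cast hm
  set Φ : Fin 2 → ℂ → ℂ := ![fun t => t ^ m, γ] with hΦdef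
  have hΦ : ∀ i, MeromorphicAtInfty (Φ i) := fun i => by
    fin_cases i
    · exact meromorphicAtInfty_pow m
    · exact hγ
  have hΦd : degMap Φ = ((m : ℝ) : EReal) := by
    refine le_antisymm (degMap_le_iff.2 fun i => ?_) ?_
    · fin_cases i
      · exact (degInfty_pow m).le
      · exact hγm
    · rw [← degInfty_pow m]
      exact le_iSup (fun i => degInfty (Φ i)) 0
  have hmem : Φ ∈ fibreCurves f c := by
    refine ⟨hΦ, ?_, ?_⟩
    · rw [hΦd]; exact_mod_cast hm'
    · refine hdeg.trans_lt ?_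
      exact_mod_cast mul_neg_of_pos_of_neg hm' hν
  refine (sInf_le (Set.mem_image_of_mem _ hmem)).trans ?_
  rw [hΦd, EReal.div_le_iff_le_mul (by exact_mod_cast hm') (EReal.coe_ne_top _), ← EReal.coe_mul]
  refine degMap_le_iff.2 fun i => ?_
  fin_cases i
  · have hg := MeromorphicAtInfty.polyComp (f - MvPolynomial.C c) hΦ
    have h1 := isBigO_of_degInfty_le hg.deriv (degInfty_deriv_le hg hdeg)
    refine degInfty_le_of_isBigO (.polyComp _ hΦ) ?_
    -- Since `f'_y` vanishes on the curve, only `f'_x` times the derivative of `t ^ m` survives in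
    -- the chain rule. The resulting exponent is `(mν - 1) - (m - 1) = m (ν - 1)`.
    have h2 : polyComp (grad f 0) Φ =ᶠ[cobounded ℂ] fun t =>
        deriv (polyComp (f - MvPolynomial.C c) Φ) t * ((m : ℂ) * t ^ (m - 1))⁻¹ := by
      filter_upwards [eventually_all.2 fun i => (hΦ i).eventually_differentiableAt, hy,
        eventually_norm_gt 0] with t ht hyt ht0
      have ht0' : t ≠ 0 := norm_pos_iff.1 ht0
      have hm0 : (m : ℂ) ≠ 0 := by exact_mod_cast hm.ne'
      have hyt' : polyComp (grad f 1) Φ t = 0 := hyt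
      have hd0 : deriv (Φ 0) t = m * t ^ (m - 1) := (hasDerivAt_pow m t).deriv
      rw [(hasDerivAt_polyComp _ ht).deriv, grad_sub_C, Fin.sum_univ_two, hyt', zero_mul,
        add_zero, hd0, mul_inv_cancel_right₀ (mul_ne_zero hm0 (pow_ne_zero _ ht0'))]
    have h3 : (fun t : ℂ => ((m : ℂ) * t ^ (m - 1))⁻¹) =O[cobounded ℂ]
        fun t => ‖t‖ ^ (-((m : ℝ) - 1)) := by
      refine IsBigO.of_bound ((m : ℝ)⁻¹) ?_
      filter_upwards with t
      rw [Real.rpow_neg (norm_nonneg t), ← Nat.cast_pred hm, Real.rpow_natCast]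
      simp [mul_comm]
    refine h2.trans_isBigO ((h1.mul h3).trans_eventuallyEq ?_)
    filter_upwards [eventually_norm_gt 0] with t ht
    rw [← Real.rpow_add ht]
    congr 1
    ring
  · refine degInfty_le_of_isBigO (.polyComp _ hΦ) ?_
    have : polyComp (grad f 1) Φ =ᶠ[cobounded ℂ] fun _ => (0 : ℂ) := hy
    exact this.trans_isBigO (isBigO_zero _ _)

theorem lojExponentNearFibre_le_of_notMem {n : ℕ} (hn : 2 ≤ n) {a : ℕ → ℂ[X]}
    (ha : ∀ i ∈ Finset.Icc 1 n, (a i).natDegree ≤ i) {f : MvPolynomial (Fin 2) ℂ}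
    (hf : f = MvPolynomial.X 1 ^ n +
      ∑ i ∈ Finset.Icc 1 n, aeval (MvPolynomial.X 0) (a i) * MvPolynomial.X 1 ^ (n - i))
    {c : ℂ} {ν : ℝ} (hν : ν < 0)
    (hmem : ν ∉ lojSet ![f - MvPolynomial.C c, MvPolynomial.pderiv 1 f]) :
    lojExponentNearFibre f c ≤ ((ν - 1 : ℝ) : EReal) := by
  have hg : ∀ z : Fin 2 → ℂ, MvPolynomial.eval z (f - MvPolynomial.C c) =
      (weighted n a c).evalEval (z 0) (z 1) := fun z => by
    rw [evalEval_weighted, hf]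
    simp [eval_aeval_X, add_sub_assoc]
  have hgy : ∀ z : Fin 2 → ℂ, MvPolynomial.eval z (MvPolynomial.pderiv 1 f) =
      (weighted n a c).derivative.evalEval (z 0) (z 1) := fun z => by
    -- The `y`-derivative is read off along the vertical line through `z`, matching `pderiv 1` with
    -- the derivative in `ℂ[X][X]`.
    have h1 := hasDerivAt_polyComp (f - MvPolynomial.C c) (Φ := ![fun _ => z 0, fun y => y])
      (t := z 1) (fun i => by fin_cases i <;> simp)
    have h2 : polyComp (f - MvPolynomial.C c) ![fun _ => z 0, fun y => y] =
        fun y => (weighted n a c).evalEval (z 0) y := by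
      funext y
      rw [polyComp, hg]
      rfl
    rw [h2] at h1
    have h3 := h1.unique (hasDerivAt_evalEval _ _ _)
    have h4 : (fun i : Fin 2 => (![fun _ => z 0, fun y => y] : Fin 2 → ℂ → ℂ) i (z 1)) = z := by
      funext i; fin_cases i <;> rfl
    rw [← h3, Fin.sum_univ_two, grad_sub_C]
    simp only [polyComp, grad, h4]
    simp
  have hnorm : ∀ z : Fin 2 → ℂ, ‖z‖ = max ‖z 0‖ ‖z 1‖ := fun z => by
    rw [Pi.norm_def, Fin.univ_succ]
    simp [Finset.sup_insert]
  have hpts := exists_polar_points (c := c) hn ha hν fun B hB => by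
    simp only [lojSet, Set.mem_ofPred_eq, not_exists, not_and, not_forall, not_le] at hmem
    obtain ⟨z, hz, hFz⟩ := hmem 1 one_pos B hB
    rw [one_mul] at hFz
    rw [hnorm z] at hz hFz
    refine ⟨z 0, z 1, hz, ?_, ?_⟩
    · rw [← hg]
      exact (norm_le_pi_norm (fun j => MvPolynomial.eval z
        (![f - MvPolynomial.C c, MvPolynomial.pderiv 1 f] j)) 0).trans hFz.le
    · rw [← hgy]
      exact (norm_le_pi_norm (fun j => MvPolynomial.eval z
        (![f - MvPolynomial.C c, MvPolynomial.pderiv 1 f] j)) 1).trans hFz.le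
  obtain ⟨K, hK⟩ := hpts
  obtain ⟨m, hm, γ, hγ, hγ0, hfreq⟩ := exists_polar_branch hn
    (p := fun x b => ‖(weighted n a c).evalEval x b‖ ≤ K * ‖x‖ ^ ν ∧ ‖b‖ ≤ K * ‖x‖) hK
  refine lojExponentNearFibre_le_of_polar (m := m) hm hγ ?_ hν ?_ ?_
  · refine degInfty_le_of_frequently (c := K) hγ (hfreq.mono fun t ht => ?_)
    rw [Real.rpow_natCast, ← norm_pow]
    exact ht.2
  · filter_upwards [hγ0] with t ht
    rw [polyComp, hgy]
    exact ht
  · refine degInfty_le_of_frequently (c := K) (.polyComp _ fun i => ?_)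
      (hfreq.mono fun t ht => ?_)
    · fin_cases i
      · exact meromorphicAtInfty_pow m
      · exact hγ
    · rw [polyComp, hg, Real.rpow_mul (norm_nonneg t), Real.rpow_natCast, ← norm_pow]
      exact ht.1

theorem lojExponentNearFibre_le_sub_one {n : ℕ} (hn : 2 ≤ n) {a : ℕ → Polynomial ℂ}
    (ha : ∀ i ∈ Finset.Icc 1 n, (a i).natDegree ≤ i) {f : MvPolynomial (Fin 2) ℂ}
    (hf : f = MvPolynomial.X 1 ^ n +
      ∑ i ∈ Finset.Icc 1 n, Polynomial.aeval (MvPolynomial.X 0) (a i) * MvPolynomial.X 1 ^ (n - i))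
    {c : ℂ} (hneg : lojExponent ![f - MvPolynomial.C c, MvPolynomial.pderiv 1 f] < 0) :
    lojExponentNearFibre f c ≤
      lojExponent ![f - MvPolynomial.C c, MvPolynomial.pderiv 1 f] - 1 := by
  refine EReal.le_of_forall_lt_iff_le.1 fun z hz => ?_
  have hz' : lojExponent ![f - MvPolynomial.C c, MvPolynomial.pderiv 1 f] <
      ((z + 1 : ℝ) : EReal) := by
    rw [EReal.coe_add]
    exact (EReal.sub_lt_iff (.inl (EReal.coe_ne_bot 1)) (.inl (EReal.coe_ne_top 1))).1 hz
  -- Testing against reals `z > L - 1` also covers `L = -∞`. The hypothesis `L < 0` leaves room for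
  -- a negative `ν` between `L` and `z + 1`.
  obtain ⟨ν, hν1, hν2⟩ := EReal.lt_iff_exists_real_btwn.1 (lt_min hz' hneg)
  rw [lt_min_iff] at hν2
  have hν0 : ν < 0 := by exact_mod_cast hν2.2
  have hνz : ν < z + 1 := by exact_mod_cast hν2.1
  refine (lojExponentNearFibre_le_of_notMem hn ha hf hν0 fun hmem => ?_).trans
    (EReal.coe_le_coe_iff.2 (by linarith))
  exact absurd (le_sSup (Set.mem_image_of_mem _ hmem)) (not_le.2 hν1)

end GradientAtInfinity

theorem theorem3p3 (n : ℕ) (hn : 2 ≤ n) (a : ℕ → Polynomial ℂ)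
    (ha : ∀ i ∈ Finset.Icc 1 n, (a i).natDegree ≤ i)
    (f : MvPolynomial (Fin 2) ℂ)
    (hf : f = MvPolynomial.X 1 ^ n +
      ∑ i ∈ Finset.Icc 1 n, Polynomial.aeval (MvPolynomial.X 0) (a i) * MvPolynomial.X 1 ^ (n - i))
    (c : ℂ)
    (hneg : GradientAtInfinity.lojExponent
      ![f - MvPolynomial.C c, MvPolynomial.pderiv 1 f] < 0) :
    GradientAtInfinity.lojExponentNearFibre f c =
      GradientAtInfinity.lojExponent ![f - MvPolynomial.C c, MvPolynomial.pderiv 1 f] - 1 :=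
  le_antisymm (GradientAtInfinity.lojExponentNearFibre_le_sub_one hn ha hf hneg)
    (GradientAtInfinity.lojExponent_sub_one_le f c)
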